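/- Let $\gamma>0$, $\lambda>0$, $\mu>0$. Let $Q=H^1(\mathbb R^+)\oplus H^1(\mathbb R^-)$ be the space of all $\psi\in L^2(\mathbb R)$ (complex valued) having a weak derivative $\psi'\in L^2$ on $\mathbb R\setminus\{0\}$, with norm $\|\psi\|_Q^2=\|\psi\|^2+\|\psi'\|^2$, where $\|\cdot\|$ is the norm of $L^2(\mathbb R)$ and $\|\cdot\|_p$ that of $L^p(\mathbb R)$; write $\psi(0\pm)$ for the one-sided boundary values at $0$ of $\psi\in Q$. Let $H_\gamma$ be the self-adjoint operator in $L^2(\mathbb R)$ given by $$D(H_\gamma)=\{\psi\in H^2(\mathbb R\setminus\{0\}) : \psi'(0+)=\psi'(0-),\ \psi(0+)-\psi(0-)=-\gamma\,\psi'(0+)\},\qquad H_\gamma\psi=-\psi''\ \text{ on } \mathbb R\setminus\{0\},$$ and let $e^{-iH_\gamma t}$, $t\in\mathbb R$, be the unitary group that it generates. For $\psi\in Q$ let $$E(\psi)=\frac12\|\psi'\|^2-\frac1{2\gamma}|\psi(0+)-\psi(0-)|^2-\frac{\lambda}{2\mu+2}\|\psi\|_{2\mu+2}^{2\mu+2}.$$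 **Proposition.** Let $0<T\le+\infty$, $\psi_0\in Q$, and let $\psi\in C^0([0,T),Q)$ be a solution with $\psi(0)=\psi_0$ of $$\psi(t)=e^{-iH_\gamma t}\psi_0+i\lambda\int_0^t e^{-iH_\gamma(t-s)}|\psi(s)|^{2\mu}\psi(s)\,ds,\qquad t\in[0,T).$$ Then, for every $t\in[0,T)$, $$\|\psi(t)\|=\|\psi_0\|\qquad\text{and}\qquad E(\psi(t))=E(\psi_0).$$ -/

import Mathlib

open MeasureTheory Filter Topology
open scoped ContDiff

noncomputable section

namespace DeltaPrime

/-- The complex Hilbert space `L²(ℝ)`. -/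
abbrev L2 : Type := Lp ℂ 2 (volume : Measure ℝ)

/-- `g ∈ L²(ℝ)` is the weak derivative of `f ∈ L²(ℝ)` on `ℝ \ {0}`: the test functions are the
smooth functions with compact support contained in `ℝ \ {0}`, so no condition links the two
half-lines. -/
def HasWeakDeriv (f g : L2) : Prop :=
  ∀ φ : ℝ → ℝ, ContDiff ℝ ∞ φ → HasCompactSupport φ → tsupport φ ⊆ {0}ᶜ →
    ∫ x, deriv φ x • f x = -∫ x, φ x • g x

theorem integrable_test_smul (f : L2) {φ : ℝ → ℝ} (hφ : Continuous φ) (hc : HasCompactSupport φ) :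
    Integrable (fun x => φ x • f x) :=
  (((Lp.memLp f).locallyIntegrable one_le_two).integrable_smul_left_of_hasCompactSupport hφ hc)

theorem HasWeakDeriv.zero : HasWeakDeriv 0 0 := by
  intro φ _ _ _
  have h : (fun x : ℝ => (0 : L2) x) =ᵐ[volume] fun _ => (0 : ℂ) := Lp.coeFn_zero ℂ 2 volume
  have h1 : ∫ x, deriv φ x • (0 : L2) x = ∫ _ : ℝ, (0 : ℂ) :=
    integral_congr_ae (h.mono fun x hx => by simp only at hx ⊢; rw [hx, smul_zero])
  have h2 : ∫ x, φ x • (0 : L2) x = ∫ _ : ℝ, (0 : ℂ) :=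
    integral_congr_ae (h.mono fun x hx => by simp only at hx ⊢; rw [hx, smul_zero])
  rw [h1, h2]; simp

theorem HasWeakDeriv.add {f₁ g₁ f₂ g₂ : L2} (h₁ : HasWeakDeriv f₁ g₁) (h₂ : HasWeakDeriv f₂ g₂) :
    HasWeakDeriv (f₁ + f₂) (g₁ + g₂) := by
  intro φ hφ hc hs
  have key : ∀ (a b : L2) (θ : ℝ → ℝ), Continuous θ → HasCompactSupport θ →
      ∫ x, θ x • (a + b : L2) x = (∫ x, θ x • a x) + ∫ x, θ x • b x := by
    intro a b θ hθ hθc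
    rw [← integral_add (integrable_test_smul a hθ hθc) (integrable_test_smul b hθ hθc)]
    refine integral_congr_ae ((Lp.coeFn_add a b).mono fun x hx => ?_)
    simp only at hx ⊢
    rw [hx, Pi.add_apply, smul_add]
  rw [key _ _ _ (hφ.continuous_deriv (by simp)) hc.deriv, key _ _ _ hφ.continuous hc,
    h₁ φ hφ hc hs, h₂ φ hφ hc hs, neg_add]

theorem HasWeakDeriv.smul (c : ℂ) {f g : L2} (h : HasWeakDeriv f g) :
    HasWeakDeriv (c • f) (c • g) := by
  intro φ hφ hc hs
  have key : ∀ (a : L2) (θ : ℝ → ℝ), ∫ x, θ x • (c • a : L2) x = c • ∫ x, θ x • a x := by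
    intro a θ
    rw [← integral_smul]
    refine integral_congr_ae ((Lp.coeFn_smul c a).mono fun x hx => ?_)
    simp only at hx ⊢
    rw [hx, Pi.smul_apply, smul_comm]
  rw [key, key, h φ hφ hc hs, smul_neg]

theorem HasWeakDeriv.eq_zero {g : L2} (h : HasWeakDeriv 0 g) : g = 0 := by
  have h0 : ∀ᵐ x : ℝ, x ∈ ({0}ᶜ : Set ℝ) → g x = 0 := by
    refine isOpen_compl_singleton.ae_eq_zero_of_integral_contDiff_smul_eq_zero
      (((Lp.memLp g).locallyIntegrable one_le_two).locallyIntegrableOn _) ?_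
    intro φ hφ hc hs
    have h1 := h φ hφ hc hs
    have h2 : ∫ x, deriv φ x • (0 : L2) x = ∫ _ : ℝ, (0 : ℂ) :=
      integral_congr_ae ((Lp.coeFn_zero ℂ 2 (volume : Measure ℝ)).mono fun x hx => by
        simp only at hx ⊢; rw [hx]; simp)
    rw [h2, integral_zero] at h1
    exact neg_eq_zero.mp h1.symm
  rw [Lp.eq_zero_iff_ae_eq_zero]
  filter_upwards [h0, Measure.ae_ne volume (0 : ℝ)] with x hx hx0
  exact hx hx0

/-- The energy space `Q = H¹(ℝ⁺) ⊕ H¹(ℝ⁻)`: functions `ψ ∈ L²(ℝ)` having a weak derivative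
`ψ' ∈ L²` on `ℝ \ {0}`. An element is stored as the pair `(ψ, ψ')` (the second entry is
determined by the first), and the norm inherited from the `ℓ²` product `L² × L²` is
`‖ψ‖_Q² = ‖ψ‖² + ‖ψ'‖²`. -/
def energySpace : Submodule ℂ (WithLp 2 (L2 × L2)) where
  carrier := {p | HasWeakDeriv p.fst p.snd}
  add_mem' ha hb := HasWeakDeriv.add ha hb
  zero_mem' := HasWeakDeriv.zero
  smul_mem' c _ h := HasWeakDeriv.smul c h

/-- The type of elements of the energy space. -/
abbrev Q : Type := energySpace

/-- The underlying `L²` function `ψ` of an element of `Q`. -/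
def Q.fn (ψ : Q) : L2 := ψ.1.fst

/-- The weak derivative `ψ'` (away from the origin) of an element of `Q`. -/
def Q.der (ψ : Q) : L2 := ψ.1.snd

/-- The filter of right neighbourhoods of `0`, up to null sets. -/
def rightZero : Filter ℝ := 𝓝[>] 0 ⊓ ae volume

/-- The filter of left neighbourhoods of `0`, up to null sets. -/
def leftZero : Filter ℝ := 𝓝[<] 0 ⊓ ae volume

/-- `f(0+)`: the essential limit of `f` at `0` from the right. For `f ∈ H¹(ℝ⁺)` it exists and is
the limit at `0+` of the continuous representative. -/
def rightTrace (f : L2) : ℂ := limUnder rightZero (fun x => f x)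

/-- `f(0-)`: the essential limit of `f` at `0` from the left. -/
def leftTrace (f : L2) : ℂ := limUnder leftZero (fun x => f x)

/-- The graph of the `δ'` Hamiltonian: the pairs `(ψ, -ψ'')` with `ψ ∈ H²(ℝ \ {0})`,
`ψ'(0+) = ψ'(0-)` and `ψ(0+) - ψ(0-) = -γ ψ'(0+)`. Here `ψ₁ = ψ'`, `ψ₂ = ψ''`, and `a`, `b`, `d`
are the one-sided boundary values `ψ(0+)`, `ψ(0-)`, `ψ'(0+) = ψ'(0-)`. -/
def hamiltonianGraph (γ : ℝ) : Submodule ℂ (L2 × L2) where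
  carrier := {p | ∃ ψ₁ ψ₂ : L2, HasWeakDeriv p.1 ψ₁ ∧ HasWeakDeriv ψ₁ ψ₂ ∧ p.2 = -ψ₂ ∧
    ∃ a b d : ℂ, Tendsto (fun x => p.1 x) rightZero (𝓝 a) ∧
      Tendsto (fun x => p.1 x) leftZero (𝓝 b) ∧
      Tendsto (fun x => ψ₁ x) rightZero (𝓝 d) ∧
      Tendsto (fun x => ψ₁ x) leftZero (𝓝 d) ∧
      a - b = -(γ : ℂ) * d}
  add_mem' := by
    rintro ⟨u, v⟩ ⟨u', v'⟩ ⟨ψ₁, ψ₂, h1, h2, h3, a, b, d, ha, hb, hd, he, hf⟩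
      ⟨ψ₁', ψ₂', h1', h2', h3', a', b', d', ha', hb', hd', he', hf'⟩
    have key : ∀ (l : Filter ℝ), l ≤ ae volume → ∀ (f g : L2) (p q : ℂ),
        Tendsto (fun x => f x) l (𝓝 p) → Tendsto (fun x => g x) l (𝓝 q) →
        Tendsto (fun x => (f + g : L2) x) l (𝓝 (p + q)) := by
      intro l hl f g p q hp hq
      refine (hp.add hq).congr' ?_
      exact hl ((Lp.coeFn_add f g).mono fun x hx => hx.symm)
    have hr : rightZero ≤ ae volume := inf_le_right
    have hl : leftZero ≤ ae volume := inf_le_right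
    refine ⟨ψ₁ + ψ₁', ψ₂ + ψ₂', h1.add h1', h2.add h2', ?_, a + a', b + b', d + d',
      key _ hr _ _ _ _ ha ha', key _ hl _ _ _ _ hb hb', key _ hr _ _ _ _ hd hd',
      key _ hl _ _ _ _ he he', ?_⟩
    · simp only at h3 h3' ⊢
      rw [Prod.snd_add, h3, h3']; simp only; abel
    · linear_combination hf + hf'
  zero_mem' := by
    have key : ∀ (l : Filter ℝ), l ≤ ae volume → Tendsto (fun x => (0 : L2) x) l (𝓝 0) := by
      intro l hl
      refine tendsto_const_nhds.congr' ?_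
      exact hl ((Lp.coeFn_zero ℂ 2 (volume : Measure ℝ)).mono fun x hx => hx.symm)
    have hr : rightZero ≤ ae volume := inf_le_right
    have hl : leftZero ≤ ae volume := inf_le_right
    exact ⟨0, 0, HasWeakDeriv.zero, HasWeakDeriv.zero, by simp, 0, 0, 0, key _ hr, key _ hl,
      key _ hr, key _ hl, by simp⟩
  smul_mem' := by
    rintro c ⟨u, v⟩ ⟨ψ₁, ψ₂, h1, h2, h3, a, b, d, ha, hb, hd, he, hf⟩
    have key : ∀ (l : Filter ℝ), l ≤ ae volume → ∀ (f : L2) (p : ℂ),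
        Tendsto (fun x => f x) l (𝓝 p) → Tendsto (fun x => (c • f : L2) x) l (𝓝 (c * p)) := by
      intro l hl f p hp
      refine (hp.const_mul c).congr' ?_
      exact hl ((Lp.coeFn_smul c f).mono fun x hx => hx.symm)
    have hr : rightZero ≤ ae volume := inf_le_right
    have hl : leftZero ≤ ae volume := inf_le_right
    refine ⟨c • ψ₁, c • ψ₂, h1.smul c, h2.smul c, ?_, c * a, c * b, c * d,
      key _ hr _ _ ha, key _ hl _ _ hb, key _ hr _ _ hd, key _ hl _ _ he, ?_⟩
    · simp only at h3 ⊢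
      rw [Prod.smul_snd, h3]; simp only; rw [smul_neg]
    · linear_combination c * hf

/-- The Hamiltonian `H_γ` of the `δ'` interaction, as an unbounded operator in `L²(ℝ)`. -/
def hamiltonian (γ : ℝ) : L2 →ₗ.[ℂ] L2 := (hamiltonianGraph γ).toLinearPMap

/-- The graph of `H_γ` is the set of pairs it was built from: `ψ''` is determined by `ψ`. -/
theorem hamiltonian_graph (γ : ℝ) : (hamiltonian γ).graph = hamiltonianGraph γ := by
  refine Submodule.toLinearPMap_graph_eq _ ?_
  rintro ⟨u, v⟩ ⟨ψ₁, ψ₂, h1, h2, h3, -⟩ hu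
  simp only at h1 h3 hu ⊢
  subst hu
  have e1 := h1.eq_zero
  subst e1
  rw [h3, h2.eq_zero, neg_zero]

/-- `U` is the unitary group `t ↦ e^{-itA}`: a strongly continuous one-parameter group of unitary
operators whose infinitesimal generator is exactly `-iA` (same domain, same values). By Stone's
theorem such a `U` exists if and only if `A` is self-adjoint, and it is then unique. -/
structure IsUnitaryGroup {E : Type*} [NormedAddCommGroup E] [InnerProductSpace ℂ E]
    [CompleteSpace E] (A : E →ₗ.[ℂ] E) (U : ℝ → E →L[ℂ] E) : Prop where
  unitary : ∀ t, U t ∈ unitary (E →L[ℂ] E)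
  zero : U 0 = 1
  add : ∀ s t, U (s + t) = U s * U t
  continuous : ∀ x, Continuous fun t => U t x
  generator : ∀ x y : E,
    (x, y) ∈ A.graph ↔ HasDerivAt (fun t => U t x) (-(Complex.I • y)) 0

open scoped Classical in
/-- The unitary group `t ↦ e^{-itA}` generated by a self-adjoint operator `A` (and `0` by
convention if `A` does not generate a unitary group). -/
def unitaryGroup {E : Type*} [NormedAddCommGroup E] [InnerProductSpace ℂ E]
    [CompleteSpace E] (A : E →ₗ.[ℂ] E) : ℝ → E →L[ℂ] E :=
  if h : ∃ U, IsUnitaryGroup A U then h.choose else 0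

open scoped Classical in
/-- The nonlinearity `|f|^{2μ} f` as an element of `L²(ℝ)`. It is square integrable for every
`f ∈ Q`, since such `f` are bounded; the value `0` is used for those `f ∈ L²(ℝ)` for which it
is not. -/
def nonlinearity (μ : ℝ) (f : L2) : L2 :=
  if h : MemLp (fun x => ‖f x‖ ^ (2 * μ) • f x) 2 (volume : Measure ℝ) then h.toLp else 0

/-- The energy
`E(ψ) = ½ ‖ψ'‖² - (1/(2γ)) |ψ(0+) - ψ(0-)|² - (l/(2μ+2)) ∫ |ψ|^{2μ+2}`, with coupling `l`. -/
def energy (γ l μ : ℝ) (ψ : Q) : ℝ :=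
  1 / 2 * ‖ψ.der‖ ^ 2 - 1 / (2 * γ) * ‖rightTrace ψ.fn - leftTrace ψ.fn‖ ^ 2
    - l / (2 * μ + 2) * ∫ x, ‖ψ.fn x‖ ^ (2 * μ + 2)

/-- The time interval `[0, T)`, where `T` may be `+∞`. -/
def timeInterval (T : EReal) : Set ℝ := {t | 0 ≤ t ∧ (t : EReal) < T}

/-- `ψ ∈ C⁰([0,T), Q)` is a solution, with initial datum `ψ₀ ∈ Q`, of
`ψ(t) = e^{-iH_γ t} ψ₀ + i l ∫₀ᵗ e^{-iH_γ (t-s)} |ψ(s)|^{2μ} ψ(s) ds`;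
the integral is a Bochner integral of a continuous `L²(ℝ)`-valued function. -/
structure IsSolution (γ l μ : ℝ) (T : EReal) (ψ₀ : Q) (ψ : ℝ → Q) : Prop where
  continuousOn : ContinuousOn ψ (timeInterval T)
  initial : 0 ∈ timeInterval T → ψ 0 = ψ₀
  duhamel : ∀ t ∈ timeInterval T,
    (ψ t).fn = unitaryGroup (hamiltonian γ) t ψ₀.fn
      + (Complex.I * l) • ∫ s in (0 : ℝ)..t,
          unitaryGroup (hamiltonian γ) (t - s) (nonlinearity μ (ψ s).fn)

end DeltaPrime

end

/-!
The curve `ψ` is only continuous in the energy space, so neither conserved quantity can be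
differentiated directly.

For the mass, the interaction picture `φ(t) = e^{itH} ψ(t)` is continuously differentiable, and
`φ'(t) = i e^{itH} F(ψ(t))` with `F(u) = λ |u|^{2μ} u` is orthogonal to `φ(t)` in the real Hilbert
space `L²`, because `⟪u, F(u)⟫` is real.

For the energy, integrating in time gains regularity: `∫ₐᶜ ψ` lies in the domain of `H`, and
`H ∫ₐᶜ ψ = i (ψ(c) - ψ(a)) + ∫ₐᶜ F(ψ)`. Let `E_h(t)` be the energy with its quadratic part taken at
the average `h⁻¹ ∫ₜᵗ⁺ʰ ψ` and its potential part averaged over `[t, t + h]`. The formula for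
`H ∫ ψ` makes the first order terms of `E_h'(t)` cancel; since `F` is Lipschitz for the `L²` norm
on bounded sets of the energy space, the remainders are bounded by a multiple of
`h⁻¹ sup ‖ψ(s) - ψ(t)‖²`, with `s` in `[t, t + h]` and the norm of `L²`. Testing the same formula
with `ψ(s) - ψ(t)` gives `‖ψ(s) - ψ(t)‖² ≤ K |s - t| ‖ψ(s) - ψ(t)‖_Q`, so `E_h'` tends to `0`
uniformly, whereas `E_h` tends to the energy.
-/

noncomputable section

namespace DeltaPrime

open Set Filter Topology MeasureTheory
open scoped ContDiff ComplexConjugate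

/-! ### Primitives of locally integrable functions -/

section Primitives

variable {E : Type*} [NormedAddCommGroup E]

theorem intervalIntegrable_of_locallyIntegrable {g : ℝ → E} (hg : LocallyIntegrable g) (a b : ℝ) :
    IntervalIntegrable g volume a b :=
  (hg.integrableOn_isCompact isCompact_uIcc).intervalIntegrable

theorem absolutelyContinuousOnInterval_of_dist_le {X Y : Type*} [PseudoMetricSpace X]
    [PseudoMetricSpace Y] {f : ℝ → X} {g : ℝ → Y} {a b : ℝ}
    (hg : AbsolutelyContinuousOnInterval g a b)
    (h : ∀ x y, dist (f x) (f y) ≤ dist (g x) (g y)) : AbsolutelyContinuousOnInterval f a b :=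
  squeeze_zero (fun _ => Finset.sum_nonneg fun _ _ => dist_nonneg)
    (fun _ => Finset.sum_le_sum fun _ _ => h _ _) hg

variable [NormedSpace ℝ E]

theorem continuous_primitive {g : ℝ → E} (hg : LocallyIntegrable g) (c : ℝ) :
    Continuous fun x => ∫ y in c..x, g y :=
  intervalIntegral.continuous_primitive (intervalIntegrable_of_locallyIntegrable hg) c

theorem absolutelyContinuousOnInterval_primitive {g : ℝ → E} (hg : LocallyIntegrable g)
    (c a b : ℝ) : AbsolutelyContinuousOnInterval (fun x => ∫ y in c..x, g y) a b := by
  have hi := intervalIntegrable_of_locallyIntegrable hg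
  refine absolutelyContinuousOnInterval_of_dist_le
    ((hi a b).norm.absolutelyContinuousOnInterval_intervalIntegral left_mem_uIcc) fun x y => ?_
  rw [dist_eq_norm, dist_eq_norm, intervalIntegral.integral_interval_sub_left (hi c x) (hi c y),
    intervalIntegral.integral_interval_sub_left (hi a x).norm (hi a y).norm]
  exact intervalIntegral.norm_integral_le_abs_integral_norm

variable [CompleteSpace E]

theorem integral_eq_sub_of_absolutelyContinuousOnInterval {F F' : ℝ → E} {a b : ℝ}
    (hF : AbsolutelyContinuousOnInterval F a b) (hF' : LocallyIntegrable F')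
    (hd : ∀ᵐ x, HasDerivAt F (F' x) x) : ∫ x in a..b, F' x = F b - F a := by
  obtain ⟨C, hC⟩ :=
    (hF.sub (absolutelyContinuousOnInterval_primitive hF' a a b)).const_of_ae_hasDerivAt_zero (by
      filter_upwards [hd, LocallyIntegrable.ae_hasDerivAt_integral hF'] with x h₁ h₂ _
      simpa only [sub_self] using h₁.sub (h₂ a))
  have ha := hC a left_mem_uIcc
  have hb := hC b right_mem_uIcc
  simp only [Pi.sub_apply, intervalIntegral.integral_same, sub_zero] at ha hb
  rw [ha, ← hb, sub_sub_cancel]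

theorem integral_deriv_smul_primitive {g : ℝ → E} (hg : LocallyIntegrable g) {φ : ℝ → ℝ}
    (hφ : ContDiff ℝ 1 φ) (hc : HasCompactSupport φ) :
    ∫ x, deriv φ x • ∫ y in (0 : ℝ)..x, g y = -∫ x, φ x • g x := by
  have hφ' : Continuous (deriv φ) := hφ.continuous_deriv le_rfl
  have hG := continuous_primitive hg 0
  obtain ⟨R, hR⟩ := hc.isCompact.isBounded.subset_ball (0 : ℝ)
  rw [Real.ball_eq_Ioo, zero_sub, zero_add] at hR
  have hφ0 : ∀ x ∉ Ioo (-R) R, φ x = 0 := fun x hx =>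
    image_eq_zero_of_notMem_tsupport fun h => hx (hR h)
  have hi₁ : Integrable fun x => deriv φ x • ∫ y in (0 : ℝ)..x, g y :=
    (hφ'.smul hG).integrable_of_hasCompactSupport hc.deriv.smul_right
  have hi₂ : Integrable fun x => φ x • g x :=
    hg.integrable_smul_left_of_hasCompactSupport hφ.continuous hc
  have hsupp : Function.support (fun x => φ x • g x + deriv φ x • ∫ y in (0 : ℝ)..x, g y) ⊆
      Ioc (-R) R := by
    intro x hx
    by_contra hxR
    have h : x ∉ tsupport φ := fun h => hxR (Ioo_subset_Ioc_self (hR h))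
    refine hx ?_
    simp only [image_eq_zero_of_notMem_tsupport h,
      image_eq_zero_of_notMem_tsupport fun h' => h (tsupport_deriv_subset h'), zero_smul, add_zero]
  have key := integral_eq_sub_of_absolutelyContinuousOnInterval (a := -R) (b := R)
    (hφ.contDiffOn.absolutelyContinuousOnInterval.fun_smul
      (absolutelyContinuousOnInterval_primitive hg 0 (-R) R))
    (hi₂.add hi₁).locallyIntegrable (by
      filter_upwards [LocallyIntegrable.ae_hasDerivAt_integral hg] with x hx
      exact (hφ.differentiable one_ne_zero x).hasDerivAt.smul (hx 0))
  rw [hφ0 R (by simp), hφ0 (-R) (by simp), zero_smul, zero_smul, sub_zero] at key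
  refine eq_neg_of_add_eq_zero_right ?_
  rw [← integral_add hi₂ hi₁, ← intervalIntegral.integral_eq_integral_of_support_subset hsupp]
  exact key

end Primitives

section DuBoisReymond

theorem exists_test_primitive {U : Set ℝ} [U.OrdConnected] {η : ℝ → ℝ} (hη : ContDiff ℝ ∞ η)
    (hc : HasCompactSupport η) (hs : tsupport η ⊆ U) (h0 : ∫ x, η x = 0) :
    ∃ φ : ℝ → ℝ, ContDiff ℝ ∞ φ ∧ HasCompactSupport φ ∧ tsupport φ ⊆ U ∧ deriv φ = η := by
  rcases (tsupport η).eq_empty_or_nonempty with he | hne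
  · obtain rfl : η = 0 := tsupport_eq_empty_iff.mp he
    exact ⟨0, contDiff_const, HasCompactSupport.zero, by simp, deriv_const' 0⟩
  obtain ⟨a, b, ha, hb, hab⟩ : ∃ a b, a ∈ U ∧ b ∈ U ∧ ∀ x ∉ Icc a b, η x = 0 :=
    ⟨_, _, hs (hc.isCompact.sInf_mem hne), hs (hc.isCompact.sSup_mem hne), fun x hx =>
      image_eq_zero_of_notMem_tsupport fun h =>
        hx (subset_Icc_csInf_csSup hc.isCompact.bddBelow hc.isCompact.bddAbove h)⟩
  set φ : ℝ → ℝ := fun x => ∫ y in Iic x, η y with hφ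
  have hi : Integrable η := hη.continuous.integrable_of_hasCompactSupport hc
  have hd (x : ℝ) : HasDerivAt φ (η x) x := by
    have hφ' : φ = fun x => φ 0 + ∫ y in (0 : ℝ)..x, η y := by
      ext x
      rw [← intervalIntegral.integral_Iic_sub_Iic hi.integrableOn hi.integrableOn, hφ]
      simp only [add_sub_cancel]
    rw [hφ']
    exact (hη.continuous.integral_hasStrictDerivAt 0 x).hasDerivAt.const_add _
  have hφs : Function.support φ ⊆ Icc a b := by
    intro x hx
    by_contra hxab
    refine hx ?_
    rcases lt_or_ge x a with hxa | hxa
    · exact setIntegral_eq_zero_of_forall_eq_zero fun y hy =>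
        hab y fun h => (h.1.trans hy).not_gt hxa
    · have hbx : b < x := not_le.mp fun h => hxab ⟨hxa, h⟩
      exact (setIntegral_eq_integral_of_forall_compl_eq_zero fun y hy =>
        hab y fun h => hy (h.2.trans hbx.le)).trans h0
  have hφt : tsupport φ ⊆ Icc a b := closure_minimal hφs isClosed_Icc
  have hd' : deriv φ = η := funext fun x => (hd x).deriv
  exact ⟨φ, contDiff_infty_iff_deriv.mpr ⟨fun x => (hd x).differentiableAt, hd'.symm ▸ hη⟩,
    isCompact_Icc.of_isClosed_subset (isClosed_tsupport φ) hφt,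
    hφt.trans (U.Icc_subset ha hb), hd'⟩

/-- The du Bois-Reymond lemma. -/
theorem ae_eq_const_of_integral_deriv_smul_eq_zero {E : Type*} [NormedAddCommGroup E]
    [NormedSpace ℝ E] [CompleteSpace E] {U : Set ℝ} (hU : IsOpen U) [U.OrdConnected]
    (hne : U.Nonempty) {h : ℝ → E} (hh : LocallyIntegrable h)
    (H : ∀ φ : ℝ → ℝ, ContDiff ℝ ∞ φ → HasCompactSupport φ → tsupport φ ⊆ U →
      ∫ x, deriv φ x • h x = 0) :
    ∃ c, ∀ᵐ x, x ∈ U → h x = c := by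
  obtain ⟨x₀, hx₀⟩ := hne
  obtain ⟨ρ, hρs, hρc, hρ, hρr, hρ1⟩ :=
    exists_contDiff_tsupport_subset (n := ⊤) (hU.mem_nhds hx₀)
  have hρ0 : 0 < ∫ x, ρ x :=
    hρ.continuous.integral_pos_of_hasCompactSupport_nonneg_nonzero hρc
      (fun x => (hρr ⟨x, rfl⟩).1) (x := x₀) (by simp [hρ1])
  set r := ∫ x, ρ x
  have hi {θ : ℝ → ℝ} (hθ : ContDiff ℝ ∞ θ) (hθc : HasCompactSupport θ) : Integrable θ :=
    hθ.continuous.integrable_of_hasCompactSupport hθc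
  have hih {θ : ℝ → ℝ} (hθ : ContDiff ℝ ∞ θ) (hθc : HasCompactSupport θ) :
      Integrable fun x => θ x • h x :=
    hh.integrable_smul_left_of_hasCompactSupport hθ.continuous hθc
  set c : E := r⁻¹ • ∫ x, ρ x • h x with hcdef
  refine ⟨c, ?_⟩
  suffices h0 : ∀ᵐ x, x ∈ U → h x - c = 0 from h0.mono fun x hx hxU => sub_eq_zero.mp (hx hxU)
  refine hU.ae_eq_zero_of_integral_contDiff_smul_eq_zero
    ((hh.sub (locallyIntegrable_const c)).locallyIntegrableOn _) fun θ hθ hθc hθs => ?_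
  -- `θ - s ρ` has vanishing integral, so it is the derivative of a test function.
  set s := (∫ x, θ x) * r⁻¹
  have hsρ : ContDiff ℝ ∞ (s • ρ) := contDiff_const.smul hρ
  have hsρc : HasCompactSupport (s • ρ) := hρc.smul_left (f := fun _ => s)
  have hsρs : tsupport (s • ρ) ⊆ U := (tsupport_smul_subset_right (fun _ => s) ρ).trans hρs
  obtain ⟨φ, hφ, hφc, hφs, hφd⟩ := exists_test_primitive (U := U) (hθ.sub hsρ) (hθc.sub hsρc)
    ((tsupport_sub θ _).trans (union_subset hθs hsρs)) (by
      simp only [Pi.smul_apply, smul_eq_mul]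
      rw [integral_sub (hi hθ hθc) ((hi hρ hρc).const_mul s), integral_const_mul,
        inv_mul_cancel_right₀ hρ0.ne', sub_self])
  have h1 := H φ hφ hφc hφs
  simp only [hφd, sub_smul, Pi.smul_apply, smul_eq_mul, mul_smul] at h1
  have hi₂ : Integrable fun x => s • ρ x • h x := (hih hρ hρc).smul s
  rw [integral_sub (hih hθ hθc) hi₂, integral_smul, sub_eq_zero] at h1
  simp only [smul_sub]
  rw [integral_sub (hih hθ hθc) ((hi hθ hθc).smul_const c), integral_smul_const, hcdef, smul_smul,
    h1, sub_self]

end DuBoisReymond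

/-! ### One-sided primitives and integration by parts -/

section IsPrimitiveOn

theorem integral_inner_primitive_add_inner_primitive {g m : ℝ → ℂ}
    (hg : LocallyIntegrable g) (hm : LocallyIntegrable m) (c d : ℂ) (a b : ℝ) :
    ∫ x in a..b, (inner ℂ (c + ∫ y in (0 : ℝ)..x, g y) (m x)
        + inner ℂ (g x) (d + ∫ y in (0 : ℝ)..x, m y))
      = inner ℂ (c + ∫ y in (0 : ℝ)..b, g y) (d + ∫ y in (0 : ℝ)..b, m y)
        - inner ℂ (c + ∫ y in (0 : ℝ)..a, g y) (d + ∫ y in (0 : ℝ)..a, m y) := by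
  have hF : Continuous fun x => c + ∫ y in (0 : ℝ)..x, g y :=
    (continuous_primitive hg 0).const_add c
  have hK : Continuous fun x => d + ∫ y in (0 : ℝ)..x, m y :=
    (continuous_primitive hm 0).const_add d
  have hac {e : ℂ} {u : ℝ → ℂ} (hu : LocallyIntegrable u) :
      AbsolutelyContinuousOnInterval (fun x => e + ∫ y in (0 : ℝ)..x, u y) a b :=
    absolutelyContinuousOnInterval_of_dist_le
      (absolutelyContinuousOnInterval_primitive hu 0 a b) fun x y => (dist_add_left _ _ _).le
  refine integral_eq_sub_of_absolutelyContinuousOnInterval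
    (F := fun x => inner ℂ (c + ∫ y in (0 : ℝ)..x, g y) (d + ∫ y in (0 : ℝ)..x, m y)) ?_ ?_ ?_
  · simp only [RCLike.inner_apply]
    exact (hac hm).fun_smul (absolutelyContinuousOnInterval_of_dist_le (hac hg) fun x y => by
      rw [dist_eq_norm, ← map_sub, RCLike.norm_conj, dist_eq_norm])
  · have hg' : LocallyIntegrable fun x => conj (g x) := fun x => by
      obtain ⟨s, hs, hi⟩ := hg x
      exact ⟨s, hs, (LinearIsometryEquiv.integrable_comp_iff Complex.conjLIE).mpr hi⟩
    simp only [RCLike.inner_apply]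
    exact (hm.smul_continuous (Complex.continuous_conj.comp hF)).add (hg'.continuous_smul hK)
  · filter_upwards [LocallyIntegrable.ae_hasDerivAt_integral hg,
      LocallyIntegrable.ae_hasDerivAt_integral hm] with x hgx hmx
    exact ((hgx 0).const_add c).inner ℂ ((hmx 0).const_add d)

theorem integrable_inner_of_memLp_two {α 𝕜 E : Type*} [MeasurableSpace α] {μ : Measure α}
    [RCLike 𝕜] [NormedAddCommGroup E] [InnerProductSpace 𝕜 E] {f g : α → E} (hf : MemLp f 2 μ)
    (hg : MemLp g 2 μ) : Integrable (fun x => inner 𝕜 (f x) (g x)) μ :=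
  (L2.integrable_inner (𝕜 := 𝕜) (hf.toLp f) (hg.toLp g)).congr <| by
    filter_upwards [hf.coeFn_toLp, hg.coeFn_toLp] with x hfx hgx
    rw [hfx, hgx]

/-- `f` is, almost everywhere on `s`, the primitive of `g` that takes the value `c` at the origin.
For `s` a half-line issuing from `0`, the constant `c` is the boundary value of `f` at `0`. -/
def IsPrimitiveOn {E : Type*} [NormedAddCommGroup E] [NormedSpace ℝ E] (s : Set ℝ) (c : E)
    (f g : ℝ → E) : Prop :=
  ∀ᵐ x : ℝ, x ∈ s → f x = c + ∫ y in (0 : ℝ)..x, g y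

namespace IsPrimitiveOn

theorem comp_neg {E : Type*} [NormedAddCommGroup E] [NormedSpace ℝ E] {s : Set ℝ} {c : E}
    {f g : ℝ → E} (h : IsPrimitiveOn s c f g) :
    IsPrimitiveOn (-s) c (fun x => f (-x)) (fun x => -g (-x)) := by
  filter_upwards [(Measure.measurePreserving_neg volume).quasiMeasurePreserving.ae h] with x hx hxs
  rw [hx hxs, intervalIntegral.integral_neg, intervalIntegral.integral_comp_neg,
    intervalIntegral.integral_symm, neg_zero]

theorem tendsto {E : Type*} [NormedAddCommGroup E] [NormedSpace ℝ E] {s : Set ℝ} {c : E}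
    {f g : ℝ → E} (h : IsPrimitiveOn s c f g) (hg : LocallyIntegrable g) :
    Tendsto f (𝓝[s] 0 ⊓ ae volume) (𝓝 c) := by
  have hc := ((continuous_primitive hg 0).const_add c).tendsto 0
  rw [intervalIntegral.integral_same, add_zero] at hc
  refine (hc.mono_left (inf_le_left.trans nhdsWithin_le_nhds)).congr' ?_
  filter_upwards [mem_inf_of_left self_mem_nhdsWithin, mem_inf_of_right h] with x hxs hx
  exact (hx hxs).symm

variable {f g k m : ℝ → ℂ} {c d : ℂ}

theorem setIntegral_Ioi_inner_add_inner (hf : MemLp f 2) (hg : MemLp g 2) (hk : MemLp k 2)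
    (hm : MemLp m 2) (hfg : IsPrimitiveOn (Ioi 0) c f g) (hkm : IsPrimitiveOn (Ioi 0) d k m)
    {a : ℝ} (ha : 0 ≤ a) :
    ∫ x in Ioi a, (inner ℂ (f x) (m x) + inner ℂ (g x) (k x))
      = -inner ℂ (c + ∫ y in (0 : ℝ)..a, g y) (d + ∫ y in (0 : ℝ)..a, m y) := by
  set F : ℝ → ℂ := fun x => c + ∫ y in (0 : ℝ)..x, g y
  set K : ℝ → ℂ := fun x => d + ∫ y in (0 : ℝ)..x, m y
  have hi : IntegrableOn (fun x => inner ℂ (f x) (m x) + inner ℂ (g x) (k x)) (Ioi a) :=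
    ((integrable_inner_of_memLp_two hf hm).add (integrable_inner_of_memLp_two hg hk)).integrableOn
  have hae : ∀ᵐ x, x ∈ Ioi a → f x = F x ∧ k x = K x := by
    filter_upwards [hfg, hkm] with x h₁ h₂ hx
    exact ⟨h₁ (ha.trans_lt hx), h₂ (ha.trans_lt hx)⟩
  have hFK : IntegrableOn (fun x => inner ℂ (F x) (K x)) (Ioi a) :=
    (integrable_inner_of_memLp_two hf hk).integrableOn.congr_fun_ae <|
      ((ae_restrict_iff' measurableSet_Ioi).mpr hae).mono fun x hx => by simp only [hx.1, hx.2]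
  have hparts : ∀ᶠ R in atTop, ∫ x in a..R, (inner ℂ (f x) (m x) + inner ℂ (g x) (k x))
      = inner ℂ (F R) (K R) - inner ℂ (F a) (K a) := by
    filter_upwards [eventually_ge_atTop a] with R hR
    rw [← integral_inner_primitive_add_inner_primitive (hg.locallyIntegrable one_le_two)
      (hm.locallyIntegrable one_le_two)]
    refine intervalIntegral.integral_congr_ae (hae.mono fun x hx hxR => ?_)
    rw [uIoc_of_le hR] at hxR
    rw [(hx hxR.1).1, (hx hxR.1).2]
  have hlim := ((intervalIntegral_tendsto_integral_Ioi a hi tendsto_id).congr' hparts).add_const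
    (inner ℂ (F a) (K a))
  simp only [sub_add_cancel] at hlim
  -- `⟪F, K⟫` is integrable near `+∞`, so its limit there can only be `0`.
  have h0 := IntegrableAtFilter.eq_zero_of_tendsto (μ := volume) ⟨Ioi a, Ioi_mem_atTop _, hFK⟩
    (fun s hs => by
      obtain ⟨b, hb⟩ := mem_atTop_sets.mp hs
      exact top_unique (Real.volume_Ici.symm.le.trans (measure_mono hb))) hlim
  exact eq_neg_of_add_eq_zero_left h0

theorem setIntegral_Iic_inner_add_inner (hf : MemLp f 2) (hg : MemLp g 2) (hk : MemLp k 2)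
    (hm : MemLp m 2) (hfg : IsPrimitiveOn (Iio 0) c f g) (hkm : IsPrimitiveOn (Iio 0) d k m) :
    ∫ x in Iic 0, (inner ℂ (f x) (m x) + inner ℂ (g x) (k x)) = inner ℂ c d := by
  have hneg := Measure.measurePreserving_neg (volume : Measure ℝ)
  have hfg' := hfg.comp_neg
  have hkm' := hkm.comp_neg
  rw [neg_Iio, neg_zero] at hfg' hkm'
  have h := setIntegral_Ioi_inner_add_inner (hf.comp_measurePreserving hneg)
    (hg.comp_measurePreserving hneg).neg (hk.comp_measurePreserving hneg)
    (hm.comp_measurePreserving hneg).neg hfg' hkm' le_rfl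
  simp only [intervalIntegral.integral_same, add_zero, Pi.neg_apply, Function.comp_apply,
    inner_neg_left, inner_neg_right, ← neg_add] at h
  rw [integral_neg, neg_inj] at h
  rw [← h, integral_comp_neg_Ioi 0 fun x => inner ℂ (f x) (m x) + inner ℂ (g x) (k x), neg_zero]

theorem ae_norm_sq_le_of_Ioi (hf : MemLp f 2) (hg : MemLp g 2)
    (h : IsPrimitiveOn (Ioi 0) c f g) :
    ∀ᵐ x, x ∈ Ioi 0 → ‖f x‖ ^ 2 ≤ ∫ y, (‖f y‖ ^ 2 + ‖g y‖ ^ 2) := by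
  have hi : Integrable fun y => ‖f y‖ ^ 2 + ‖g y‖ ^ 2 :=
    hf.integrable_norm_pow two_ne_zero |>.add (hg.integrable_norm_pow two_ne_zero)
  filter_upwards [h] with x hx hx0
  have hparts := setIntegral_Ioi_inner_add_inner hf hg hf hg h h (le_of_lt hx0)
  rw [← hx hx0, inner_self_eq_norm_sq_to_K] at hparts
  calc ‖f x‖ ^ 2 = ‖∫ y in Ioi x, (inner ℂ (f y) (g y) + inner ℂ (g y) (f y))‖ := by
        rw [hparts, norm_neg, norm_pow, RCLike.norm_ofReal, abs_norm]
    _ ≤ ∫ y in Ioi x, (‖f y‖ ^ 2 + ‖g y‖ ^ 2) := by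
        refine norm_integral_le_of_norm_le hi.integrableOn (Eventually.of_forall fun y => ?_)
        calc _ ≤ ‖f y‖ * ‖g y‖ + ‖g y‖ * ‖f y‖ :=
              norm_add_le_of_le (norm_inner_le_norm _ _) (norm_inner_le_norm _ _)
          _ ≤ _ := by linarith [two_mul_le_add_sq ‖f y‖ ‖g y‖]
    _ ≤ ∫ y, (‖f y‖ ^ 2 + ‖g y‖ ^ 2) :=
        setIntegral_le_integral hi (Eventually.of_forall fun y => by positivity)

theorem ae_norm_sq_le_of_Iio (hf : MemLp f 2) (hg : MemLp g 2)
    (h : IsPrimitiveOn (Iio 0) c f g) :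
    ∀ᵐ x, x ∈ Iio 0 → ‖f x‖ ^ 2 ≤ ∫ y, (‖f y‖ ^ 2 + ‖g y‖ ^ 2) := by
  have hneg := Measure.measurePreserving_neg (volume : Measure ℝ)
  have h' := h.comp_neg
  rw [neg_Iio, neg_zero] at h'
  have hle := ae_norm_sq_le_of_Ioi (hf.comp_measurePreserving hneg)
    (hg.comp_measurePreserving hneg).neg h'
  simp only [Pi.neg_apply, Function.comp_apply, norm_neg] at hle
  rw [integral_neg_eq_self fun y => ‖f y‖ ^ 2 + ‖g y‖ ^ 2] at hle
  filter_upwards [hneg.quasiMeasurePreserving.ae hle] with x hx hx0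
  simpa only [neg_neg] using hx (mem_Ioi.mpr (neg_pos.mpr hx0))

end IsPrimitiveOn

end IsPrimitiveOn

/-! ### Boundary values and the energy space -/

section Traces

theorem neBot_nhdsWithin_inf_ae {X : Type*} [TopologicalSpace X] [MeasurableSpace X]
    {μ : Measure X} [μ.IsOpenPosMeasure] {s : Set X} {x : X} (hs : IsOpen s) (hx : x ∈ closure s) :
    (𝓝[s] x ⊓ ae μ).NeBot := by
  refine inf_neBot_iff.mpr fun t ht t' ht' => ?_
  obtain ⟨u, hu, hxu, hut⟩ := mem_nhdsWithin.mp ht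
  exact ((Measure.dense_of_ae ht').inter_open_nonempty _ (hu.inter hs)
    (mem_closure_iff.mp hx u hu hxu)).mono (inter_subset_inter_left _ hut)

instance rightZero_neBot : rightZero.NeBot := neBot_nhdsWithin_inf_ae isOpen_Ioi (by simp)

instance leftZero_neBot : leftZero.NeBot := neBot_nhdsWithin_inf_ae isOpen_Iio (by simp)

theorem rightZero_le_ae : rightZero ≤ ae volume := inf_le_right

theorem leftZero_le_ae : leftZero ≤ ae volume := inf_le_right

namespace HasWeakDeriv

variable {f f' g g' : L2}

theorem exists_isPrimitiveOn (h : HasWeakDeriv f g) {U : Set ℝ} (hU : IsOpen U)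
    [U.OrdConnected] (hne : U.Nonempty) (h0 : U ⊆ {0}ᶜ) : ∃ c, IsPrimitiveOn U c f g := by
  have hf : LocallyIntegrable f := (Lp.memLp f).locallyIntegrable one_le_two
  have hg : LocallyIntegrable g := (Lp.memLp g).locallyIntegrable one_le_two
  have hG := continuous_primitive hg 0
  obtain ⟨c, hc⟩ := ae_eq_const_of_integral_deriv_smul_eq_zero hU hne
    (hf.sub hG.locallyIntegrable) fun φ hφ hφc hφU => by
      have hφ' : Continuous (deriv φ) := hφ.continuous_deriv (by simp)
      have hi : Integrable fun x => deriv φ x • ∫ y in (0 : ℝ)..x, g y :=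
        (hφ'.smul hG).integrable_of_hasCompactSupport hφc.deriv.smul_right
      simp only [Pi.sub_apply, smul_sub]
      rw [integral_sub (integrable_test_smul f hφ' hφc.deriv) hi, h φ hφ hφc (hφU.trans h0),
        integral_deriv_smul_primitive hg (hφ.of_le (by simp)) hφc, sub_self]
  exact ⟨c, hc.mono fun x hx hxU => eq_add_of_sub_eq (hx hxU)⟩

theorem isPrimitiveOn_Ioi (h : HasWeakDeriv f g) :
    IsPrimitiveOn (Ioi 0) (rightTrace f) f g := by
  obtain ⟨c, hc⟩ := h.exists_isPrimitiveOn isOpen_Ioi nonempty_Ioi fun x hx => ne_of_gt hx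
  have hlim : Tendsto f rightZero (𝓝 c) := hc.tendsto ((Lp.memLp g).locallyIntegrable one_le_two)
  rwa [rightTrace, hlim.limUnder_eq]

theorem isPrimitiveOn_Iio (h : HasWeakDeriv f g) :
    IsPrimitiveOn (Iio 0) (leftTrace f) f g := by
  obtain ⟨c, hc⟩ := h.exists_isPrimitiveOn isOpen_Iio nonempty_Iio fun x hx => ne_of_lt hx
  have hlim : Tendsto f leftZero (𝓝 c) := hc.tendsto ((Lp.memLp g).locallyIntegrable one_le_two)
  rwa [leftTrace, hlim.limUnder_eq]

theorem tendsto_rightTrace (h : HasWeakDeriv f g) : Tendsto f rightZero (𝓝 (rightTrace f)) :=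
  h.isPrimitiveOn_Ioi.tendsto ((Lp.memLp g).locallyIntegrable one_le_two)

theorem tendsto_leftTrace (h : HasWeakDeriv f g) : Tendsto f leftZero (𝓝 (leftTrace f)) :=
  h.isPrimitiveOn_Iio.tendsto ((Lp.memLp g).locallyIntegrable one_le_two)

theorem unique (h : HasWeakDeriv f g) (h' : HasWeakDeriv f g') : g = g' := by
  have h0 := h.add (h'.smul (-1))
  rw [neg_one_smul, neg_one_smul, add_neg_cancel, ← sub_eq_add_neg] at h0
  exact sub_eq_zero.mp h0.eq_zero

theorem inner_add_inner (hf : HasWeakDeriv f f') (hg : HasWeakDeriv g g') :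
    inner ℂ f g' + inner ℂ f' g =
      inner ℂ (leftTrace f) (leftTrace g) - inner ℂ (rightTrace f) (rightTrace g) := by
  have hi : Integrable fun x => inner ℂ (f x) (g' x) + inner ℂ (f' x) (g x) :=
    (L2.integrable_inner f g').add (L2.integrable_inner f' g)
  have hright := IsPrimitiveOn.setIntegral_Ioi_inner_add_inner (Lp.memLp f) (Lp.memLp f')
    (Lp.memLp g) (Lp.memLp g') hf.isPrimitiveOn_Ioi hg.isPrimitiveOn_Ioi le_rfl
  have hleft := IsPrimitiveOn.setIntegral_Iic_inner_add_inner (Lp.memLp f) (Lp.memLp f')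
    (Lp.memLp g) (Lp.memLp g') hf.isPrimitiveOn_Iio hg.isPrimitiveOn_Iio
  simp only [intervalIntegral.integral_same, add_zero] at hright
  rw [L2.inner_def, L2.inner_def,
    ← integral_add (L2.integrable_inner f g') (L2.integrable_inner f' g),
    ← intervalIntegral.integral_Iic_add_Ioi (b := 0) hi.integrableOn hi.integrableOn, hleft,
    hright, sub_eq_add_neg]

end HasWeakDeriv

theorem continuous_integral_smul {θ : ℝ → ℝ} (hθ : Continuous θ) (hc : HasCompactSupport θ) :
    Continuous fun f : L2 => ∫ x, θ x • f x := by
  have hm : MemLp (fun x => (θ x : ℂ)) 2 (volume : Measure ℝ) :=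
    (Complex.continuous_ofReal.comp hθ).memLp_of_hasCompactSupport
      (hc.comp_left Complex.ofReal_zero)
  refine (continuous_const.inner continuous_id : Continuous fun f : L2 =>
    inner ℂ hm.toLp f).congr fun f => ?_
  rw [L2.inner_def]
  refine integral_congr_ae ?_
  filter_upwards [hm.coeFn_toLp] with x hx
  rw [hx, RCLike.inner_apply, Complex.conj_ofReal, mul_comm, Complex.real_smul]

theorem isClosed_energySpace : IsClosed (energySpace : Set (WithLp 2 (L2 × L2))) := by
  have h : (energySpace : Set (WithLp 2 (L2 × L2))) =
      {p | ∀ φ : ℝ → ℝ, ContDiff ℝ ∞ φ → HasCompactSupport φ → tsupport φ ⊆ {0}ᶜ →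
        ∫ x, deriv φ x • p.fst x = -∫ x, φ x • p.snd x} := rfl
  rw [h]
  simp only [Set.ofPred_forall]
  refine isClosed_iInter fun φ => isClosed_iInter fun hφ => isClosed_iInter fun hc =>
    isClosed_iInter fun _ => isClosed_eq ?_ ?_
  · exact (continuous_integral_smul (hφ.continuous_deriv (by simp)) hc.deriv).comp
      (WithLp.fstL 2 ℂ L2 L2).continuous
  · exact ((continuous_integral_smul hφ.continuous hc).comp
      (WithLp.sndL 2 ℂ L2 L2).continuous).neg

instance completeSpace_Q : CompleteSpace Q := isClosed_energySpace.completeSpace_coe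

theorem norm_sq_eq_integral (f : L2) : ‖f‖ ^ 2 = ∫ x, ‖f x‖ ^ 2 := by
  have h := L2.inner_def (𝕜 := ℂ) f f
  simp only [inner_self_eq_norm_sq_to_K, ← RCLike.ofReal_pow] at h
  rwa [integral_ofReal, RCLike.ofReal_inj] at h

end Traces

namespace Q

theorem hasWeakDeriv (ψ : Q) : HasWeakDeriv ψ.fn ψ.der := ψ.2

/-- The inclusion of the energy space in `L²(ℝ)`. -/
def fnL : Q →L[ℂ] L2 := (WithLp.fstL 2 ℂ L2 L2).comp energySpace.subtypeL

/-- The weak derivative as a bounded operator from the energy space to `L²(ℝ)`. -/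
def derL : Q →L[ℂ] L2 := (WithLp.sndL 2 ℂ L2 L2).comp energySpace.subtypeL

theorem fnL_apply (ψ : Q) : fnL ψ = ψ.fn := rfl

theorem norm_sq (ψ : Q) : ‖ψ‖ ^ 2 = ‖ψ.fn‖ ^ 2 + ‖ψ.der‖ ^ 2 :=
  WithLp.prod_norm_sq_eq_of_L2 ψ.1

theorem fnL_injective : Function.Injective fnL := by
  intro φ ψ h
  have hfn : φ.fn = ψ.fn := h
  have hder : φ.der = ψ.der := φ.hasWeakDeriv.unique (hfn ▸ ψ.hasWeakDeriv)
  exact Subtype.ext (WithLp.ofLp_injective 2 (Prod.ext hfn hder))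

theorem norm_sq_eq_integral (ψ : Q) :
    ‖ψ‖ ^ 2 = ∫ x, (‖ψ.fn x‖ ^ 2 + ‖ψ.der x‖ ^ 2) := by
  rw [norm_sq, DeltaPrime.norm_sq_eq_integral, DeltaPrime.norm_sq_eq_integral,
    ← integral_add ((Lp.memLp ψ.fn).integrable_norm_pow two_ne_zero)
      ((Lp.memLp ψ.der).integrable_norm_pow two_ne_zero)]

theorem ae_norm_le (ψ : Q) : ∀ᵐ x : ℝ, ‖ψ.fn x‖ ≤ ‖ψ‖ := by
  filter_upwards [ψ.hasWeakDeriv.isPrimitiveOn_Ioi.ae_norm_sq_le_of_Ioi (Lp.memLp _) (Lp.memLp _),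
    ψ.hasWeakDeriv.isPrimitiveOn_Iio.ae_norm_sq_le_of_Iio (Lp.memLp _) (Lp.memLp _),
    Measure.ae_ne volume (0 : ℝ)] with x hright hleft hx0
  refine le_of_sq_le_sq ?_ (norm_nonneg ψ)
  rw [norm_sq_eq_integral]
  exact hx0.lt_or_gt.elim hleft hright

/-- The essential limit along a filter `l`, as a bounded linear functional on the energy space.
The limit has to exist for every `ψ`, since `limUnder` is a junk value otherwise. -/
def traceL (l : Filter ℝ) [l.NeBot] (hl : l ≤ ae volume)
    (hlim : ∀ ψ : Q, Tendsto ψ.fn l (𝓝 (limUnder l ψ.fn))) : Q →L[ℂ] ℂ :=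
  LinearMap.mkContinuous
    { toFun := fun ψ => limUnder l ψ.fn
      map_add' := fun ψ φ => (((hlim ψ).add (hlim φ)).congr'
        (hl (Lp.coeFn_add ψ.fn φ.fn).symm)).limUnder_eq
      map_smul' := fun c ψ => (((hlim ψ).const_smul c).congr'
        (hl (Lp.coeFn_smul c ψ.fn).symm)).limUnder_eq }
    1 fun ψ => by
      rw [one_mul]
      exact le_of_tendsto (hlim ψ).norm (hl ψ.ae_norm_le)

/-- The jump `ψ(0+) - ψ(0-)` as a bounded linear functional on the energy space. -/
def jump : Q →L[ℂ] ℂ :=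
  traceL rightZero rightZero_le_ae (fun ψ => ψ.hasWeakDeriv.tendsto_rightTrace) -
    traceL leftZero leftZero_le_ae (fun ψ => ψ.hasWeakDeriv.tendsto_leftTrace)

theorem jump_apply (ψ : Q) : jump ψ = rightTrace ψ.fn - leftTrace ψ.fn := rfl

end Q

/-- The sesquilinear form of `H_γ`. -/
def form (γ : ℝ) : Q →L⋆[ℂ] Q →L[ℂ] ℂ :=
  (innerSL ℂ).bilinearComp Q.derL Q.derL - (γ : ℂ)⁻¹ • (innerSL ℂ).bilinearComp Q.jump Q.jump

theorem form_apply (γ : ℝ) (v u : Q) :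
    form γ v u = inner ℂ v.der u.der - (γ : ℂ)⁻¹ * inner ℂ (Q.jump v) (Q.jump u) := rfl

theorem conj_form (γ : ℝ) (v u : Q) : conj (form γ v u) = form γ u v := by
  rw [form_apply, form_apply, map_sub, map_mul, inner_conj_symm, inner_conj_symm, map_inv₀,
    Complex.conj_ofReal]

theorem inner_eq_form {γ : ℝ} (hγ : γ ≠ 0) {u : Q} {y : L2} (h : (u.fn, y) ∈ hamiltonianGraph γ)
    (v : Q) : inner ℂ v.fn y = form γ v u := by
  obtain ⟨ψ₁, ψ₂, h₁, h₂, h₃, a, b, d, ha, hb, hd, hd', hj⟩ := h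
  obtain rfl : ψ₁ = u.der := h₁.unique u.hasWeakDeriv
  have hjump : Q.jump u = (-γ : ℂ) • d := by
    rw [smul_eq_mul, ← hj, Q.jump_apply, rightTrace, leftTrace, Tendsto.limUnder_eq ha,
      Tendsto.limUnder_eq hb]
  have hright : rightTrace u.der = d := hd.limUnder_eq
  have hleft : leftTrace u.der = d := hd'.limUnder_eq
  have hγ' : (γ : ℂ) ≠ 0 := Complex.ofReal_ne_zero.mpr hγ
  have hparts := v.hasWeakDeriv.inner_add_inner h₂
  obtain rfl : y = -ψ₂ := h₃
  rw [hright, hleft, ← inner_sub_left, ← neg_sub (rightTrace v.fn), ← Q.jump_apply,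
    inner_neg_left] at hparts
  rw [form_apply, hjump, inner_neg_right, inner_smul_right]
  field_simp
  linear_combination -hparts

theorem re_form_self (γ : ℝ) (u : Q) :
    (form γ u u).re = ‖u.der‖ ^ 2 - 1 / γ * ‖rightTrace u.fn - leftTrace u.fn‖ ^ 2 := by
  have h : form γ u u = ((‖u.der‖ ^ 2 - 1 / γ * ‖Q.jump u‖ ^ 2 : ℝ) : ℂ) := by
    rw [form_apply, inner_self_eq_norm_sq_to_K, inner_self_eq_norm_sq_to_K]
    push_cast
    rw [one_div]
    rfl
  rw [h, Complex.ofReal_re, Q.jump_apply]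

/-! ### The power nonlinearity -/

section Power

theorem sub_rpow_mul_le {a b p : ℝ} (hb : 0 ≤ b) (hab : b ≤ a) (hp : 0 ≤ p) :
    (a ^ p - b ^ p) * b ≤ (p + 1) * a ^ p * (a - b) := by
  rcases (hb.trans hab).eq_or_lt with rfl | ha
  · obtain rfl : b = 0 := le_antisymm hab hb
    simp only [sub_self, mul_zero, le_refl]
  have hbernoulli := one_add_mul_self_le_rpow_one_add (s := b / a - 1) (p := p + 1)
    (by linarith [div_nonneg hb ha.le]) (by linarith)
  rw [add_sub_cancel, Real.div_rpow hb ha.le, le_div_iff₀ (by positivity),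
    Real.rpow_add_one' ha.le (by linarith), Real.rpow_add_one' hb (by linarith)] at hbernoulli
  have hcancel :
      (1 + (p + 1) * (b / a - 1)) * (a ^ p * a) = a ^ p * a - (p + 1) * a ^ p * (a - b) := by
    field_simp
    ring
  have hmono : a ^ p * b ≤ a ^ p * a := by gcongr
  linarith

theorem norm_rpow_smul_sub_rpow_smul_le {F : Type*} [NormedAddCommGroup F] [NormedSpace ℝ F]
    {p M : ℝ} (hp : 0 ≤ p) {z w : F} (hz : ‖z‖ ≤ M) (hw : ‖w‖ ≤ M) :
    ‖‖z‖ ^ p • z - ‖w‖ ^ p • w‖ ≤ (p + 2) * M ^ p * ‖z - w‖ := by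
  wlog h : ‖w‖ ≤ ‖z‖ generalizing z w
  · rw [norm_sub_rev, norm_sub_rev z w]
    exact this hw hz (not_le.mp h).le
  have hpow : ‖w‖ ^ p ≤ ‖z‖ ^ p := Real.rpow_le_rpow (norm_nonneg _) h hp
  have hn : ‖z‖ - ‖w‖ ≤ ‖z - w‖ := norm_sub_norm_le _ _
  calc ‖‖z‖ ^ p • z - ‖w‖ ^ p • w‖
      = ‖‖z‖ ^ p • (z - w) + (‖z‖ ^ p - ‖w‖ ^ p) • w‖ := by
        rw [smul_sub, sub_smul, sub_add_sub_cancel]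
    _ ≤ ‖z‖ ^ p * ‖z - w‖ + (‖z‖ ^ p - ‖w‖ ^ p) * ‖w‖ := by
        refine (norm_add_le _ _).trans_eq ?_
        rw [norm_smul, norm_smul, Real.norm_of_nonneg (by positivity),
          Real.norm_of_nonneg (sub_nonneg.mpr hpow)]
    _ ≤ ‖z‖ ^ p * ‖z - w‖ + (p + 1) * ‖z‖ ^ p * (‖z‖ - ‖w‖) :=
        add_le_add_right (sub_rpow_mul_le (norm_nonneg _) h hp) _
    _ ≤ ‖z‖ ^ p * ‖z - w‖ + (p + 1) * ‖z‖ ^ p * ‖z - w‖ := by gcongr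
    _ = (p + 2) * ‖z‖ ^ p * ‖z - w‖ := by ring
    _ ≤ (p + 2) * M ^ p * ‖z - w‖ := by gcongr

theorem abs_norm_rpow_sub_sub_inner_le {F : Type*} [NormedAddCommGroup F] [InnerProductSpace ℝ F]
    {p M : ℝ} (hp : 0 ≤ p) {z w : F} (hz : ‖z‖ ≤ M) (hw : ‖w‖ ≤ M) :
    |‖z‖ ^ (p + 2) - ‖w‖ ^ (p + 2) - (p + 2) * inner ℝ (‖w‖ ^ p • w) (z - w)|
      ≤ (p + 2) ^ 2 * M ^ p * ‖z - w‖ ^ 2 := by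
  have hM : 0 ≤ M := (norm_nonneg _).trans hz
  have hderiv : ∀ ζ ∈ segment ℝ w z, HasFDerivWithinAt
      (fun ζ => ‖ζ‖ ^ (p + 2) - (p + 2) * innerSL ℝ (‖w‖ ^ p • w) ζ)
      ((p + 2) • innerSL ℝ (‖ζ‖ ^ p • ζ - ‖w‖ ^ p • w)) (segment ℝ w z) ζ := by
    intro ζ _
    have hnorm := hasFDerivAt_norm_rpow ζ (p := p + 2) (by linarith)
    have hlin := (innerSL ℝ (‖w‖ ^ p • w)).hasFDerivAt (x := ζ) |>.const_mul (p + 2)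
    refine ((hnorm.sub hlin).congr_fderiv ?_).hasFDerivWithinAt
    rw [map_sub, map_smul, map_smul, smul_sub, smul_smul, smul_smul, add_sub_cancel_right]
  have hbound : ∀ ζ ∈ segment ℝ w z,
      ‖(p + 2) • innerSL ℝ (‖ζ‖ ^ p • ζ - ‖w‖ ^ p • w)‖
        ≤ (p + 2) * ((p + 2) * M ^ p * ‖z - w‖) := by
    intro ζ hζ
    have hζM : ‖ζ‖ ≤ M := mem_closedBall_zero_iff.mp ((convex_closedBall (0 : F) M).segment_subset
      (mem_closedBall_zero_iff.mpr hw) (mem_closedBall_zero_iff.mpr hz) hζ)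
    rw [norm_smul, innerSL_apply_norm, Real.norm_of_nonneg (by linarith)]
    calc (p + 2) * ‖‖ζ‖ ^ p • ζ - ‖w‖ ^ p • w‖ ≤ (p + 2) * ((p + 2) * M ^ p * ‖ζ - w‖) := by
          gcongr
          exact norm_rpow_smul_sub_rpow_smul_le hp hζM hw
      _ ≤ (p + 2) * ((p + 2) * M ^ p * ‖z - w‖) := by
          gcongr
          exact norm_sub_le_of_mem_segment hζ
  have hmvt := (convex_segment w z).norm_image_sub_le_of_norm_hasFDerivWithin_le hderiv hbound
    (left_mem_segment ℝ w z) (right_mem_segment ℝ w z)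
  simp only [innerSL_apply_apply, Real.norm_eq_abs] at hmvt
  calc _ = |‖z‖ ^ (p + 2) - (p + 2) * inner ℝ (‖w‖ ^ p • w) z
          - (‖w‖ ^ (p + 2) - (p + 2) * inner ℝ (‖w‖ ^ p • w) w)| := by
        rw [inner_sub_right]
        ring_nf
    _ ≤ (p + 2) * ((p + 2) * M ^ p * ‖z - w‖) * ‖z - w‖ := hmvt
    _ = (p + 2) ^ 2 * M ^ p * ‖z - w‖ ^ 2 := by ring

end Power

section Nonlinearity

variable {μ M : ℝ} {f g : L2}

theorem coeFn_nonlinearity (hμ : 0 ≤ μ) (hf : ∀ᵐ x, ‖f x‖ ≤ M) :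
    nonlinearity μ f =ᵐ[volume] fun x => ‖f x‖ ^ (2 * μ) • f x := by
  have hcont : Continuous fun z : ℂ => ‖z‖ ^ (2 * μ) • z :=
    (continuous_norm.rpow_const fun _ => Or.inr (by positivity)).smul continuous_id
  have hmem : MemLp (fun x => ‖f x‖ ^ (2 * μ) • f x) 2 (volume : Measure ℝ) := by
    refine (Lp.memLp f).of_le_mul (c := M ^ (2 * μ))
      (hcont.comp_aestronglyMeasurable (Lp.aestronglyMeasurable f)) (hf.mono fun x hx => ?_)
    rw [norm_smul, Real.norm_of_nonneg (by positivity)]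
    gcongr
  rw [nonlinearity, dif_pos hmem]
  exact hmem.coeFn_toLp

theorem norm_nonlinearity_sub_le (hμ : 0 ≤ μ) (hf : ∀ᵐ x, ‖f x‖ ≤ M) (hg : ∀ᵐ x, ‖g x‖ ≤ M) :
    ‖nonlinearity μ f - nonlinearity μ g‖ ≤ (2 * μ + 2) * M ^ (2 * μ) * ‖f - g‖ := by
  refine Lp.norm_le_mul_norm_of_ae_le_mul ?_
  filter_upwards [coeFn_nonlinearity hμ hf, coeFn_nonlinearity hμ hg, hf, hg,
    Lp.coeFn_sub (nonlinearity μ f) (nonlinearity μ g), Lp.coeFn_sub f g]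
    with x hNf hNg hfx hgx hsubN hsub
  rw [hsubN, hsub, Pi.sub_apply, Pi.sub_apply, hNf, hNg]
  exact norm_rpow_smul_sub_rpow_smul_le (by positivity) hfx hgx

theorem integrable_norm_rpow_two_mul_add_two (hμ : 0 ≤ μ) (hf : ∀ᵐ x, ‖f x‖ ≤ M) :
    Integrable fun x => ‖f x‖ ^ (2 * μ + 2) := by
  have hcont : Continuous fun z : ℂ => ‖z‖ ^ (2 * μ + 2) :=
    continuous_norm.rpow_const fun _ => Or.inr (by positivity)
  refine (((Lp.memLp f).integrable_norm_pow two_ne_zero).const_mul (M ^ (2 * μ))).mono'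
    (hcont.comp_aestronglyMeasurable (Lp.aestronglyMeasurable f)) (hf.mono fun x hx => ?_)
  rw [Real.norm_of_nonneg (by positivity),
    Real.rpow_add_of_nonneg (norm_nonneg _) (by positivity) two_pos.le, Real.rpow_two]
  gcongr

theorem abs_integral_norm_rpow_sub_sub_inner_le (hμ : 0 ≤ μ) (hf : ∀ᵐ x, ‖f x‖ ≤ M)
    (hg : ∀ᵐ x, ‖g x‖ ≤ M) :
    |(∫ x, ‖f x‖ ^ (2 * μ + 2)) - (∫ x, ‖g x‖ ^ (2 * μ + 2))
        - (2 * μ + 2) * (inner ℂ (nonlinearity μ g) (f - g)).re|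
      ≤ (2 * μ + 2) ^ 2 * M ^ (2 * μ) * ‖f - g‖ ^ 2 := by
  have hi := L2.integrable_inner (𝕜 := ℂ) (nonlinearity μ g) (f - g)
  have hif := integrable_norm_rpow_two_mul_add_two hμ hf
  have hig := integrable_norm_rpow_two_mul_add_two hμ hg
  have hi' : Integrable fun x =>
      (2 * μ + 2) * (inner ℂ (nonlinearity μ g x) ((f - g : L2) x)).re := hi.re.const_mul _
  have hd : Integrable fun x => ‖f x‖ ^ (2 * μ + 2) - ‖g x‖ ^ (2 * μ + 2) := hif.sub hig
  have hre : (inner ℂ (nonlinearity μ g) (f - g)).re =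
      ∫ x, (inner ℂ (nonlinearity μ g x) ((f - g : L2) x)).re := (integral_re hi).symm
  rw [hre, ← integral_const_mul, ← integral_sub hif hig, ← integral_sub hd hi',
    norm_sq_eq_integral, ← integral_const_mul, ← Real.norm_eq_abs]
  refine norm_integral_le_of_norm_le
    (((Lp.memLp (f - g)).integrable_norm_pow two_ne_zero).const_mul _) ?_
  filter_upwards [coeFn_nonlinearity hμ hg, hf, hg, Lp.coeFn_sub f g] with x hNg hfx hgx hsub
  rw [hsub, Pi.sub_apply, hNg, Real.norm_eq_abs]
  exact abs_norm_rpow_sub_sub_inner_le (by positivity) hfx hgx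

theorem im_inner_nonlinearity (hμ : 0 ≤ μ) (hf : ∀ᵐ x, ‖f x‖ ≤ M) :
    (inner ℂ f (nonlinearity μ f)).im = 0 := by
  have him : (inner ℂ f (nonlinearity μ f)).im =
      ∫ x, (inner ℂ (f x) (nonlinearity μ f x)).im :=
    (integral_im (L2.integrable_inner (𝕜 := ℂ) f (nonlinearity μ f))).symm
  rw [him]
  refine integral_eq_zero_of_ae ?_
  filter_upwards [coeFn_nonlinearity hμ hf] with x hx
  have hself : (inner ℂ (f x) (f x)).im = 0 := inner_self_im (𝕜 := ℂ) (f x)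
  rw [hx, inner_smul_right_eq_smul, Complex.smul_im, hself, smul_zero, Pi.zero_apply]

end Nonlinearity

/-! ### Mild solutions -/

section Mild

variable {E : Type*} [NormedAddCommGroup E] [InnerProductSpace ℂ E] [CompleteSpace E]

/-- The mild solution `U(t) x₀ + ∫₀ᵗ U(t-s) f(s) ds` of `i w' = A w + i f`, `w(0) = x₀`, where
`U(t) = e^{-itA}`. -/
def mild (U : ℝ → E →L[ℂ] E) (x₀ : E) (f : ℝ → E) (t : ℝ) : E :=
  U t x₀ + ∫ s in (0 : ℝ)..t, U (t - s) (f s)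

/-- The mild solution in the interaction picture, `U(-t) w(t)`. Unlike `w` it is differentiable. -/
def interaction (U : ℝ → E →L[ℂ] E) (x₀ : E) (f : ℝ → E) (t : ℝ) : E :=
  x₀ + ∫ s in (0 : ℝ)..t, U (-s) (f s)

namespace IsUnitaryGroup

variable {A : E →ₗ.[ℂ] E} {U : ℝ → E →L[ℂ] E} {f : ℝ → E}

theorem inner_apply_apply (hU : IsUnitaryGroup A U) (t : ℝ) (x y : E) :
    inner ℂ (U t x) (U t y) = inner ℂ x y :=
  ContinuousLinearMap.inner_map_map_of_mem_unitary (hU.unitary t) x y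

theorem norm_apply (hU : IsUnitaryGroup A U) (t : ℝ) (x : E) : ‖U t x‖ = ‖x‖ :=
  ContinuousLinearMap.norm_map_of_mem_unitary (hU.unitary t) x

theorem zero_apply (hU : IsUnitaryGroup A U) (x : E) : U 0 x = x := by
  rw [hU.zero, one_apply_eq_self]

theorem add_apply (hU : IsUnitaryGroup A U) (s t : ℝ) (x : E) : U (s + t) x = U s (U t x) := by
  rw [hU.add, mul_apply_eq_comp]

theorem apply_neg_apply (hU : IsUnitaryGroup A U) (t : ℝ) (x : E) : U t (U (-t) x) = x := by
  rw [← hU.add_apply, add_neg_cancel, hU.zero_apply]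

theorem tendsto_apply {ι : Type*} {l : Filter ι} (hU : IsUnitaryGroup A U) {τ : ι → ℝ} {x : ι → E}
    {t : ℝ} {y : E} (hτ : Tendsto τ l (𝓝 t)) (hx : Tendsto x l (𝓝 y)) :
    Tendsto (fun i => U (τ i) (x i)) l (𝓝 (U t y)) := by
  have hsmall : Tendsto (fun i => U (τ i) (x i - y)) l (𝓝 0) := by
    rw [tendsto_zero_iff_norm_tendsto_zero]
    simpa only [hU.norm_apply] using tendsto_iff_norm_sub_tendsto_zero.mp hx
  simpa only [Function.comp_def, ← map_add, sub_add_cancel, zero_add] using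
    hsmall.add (((hU.continuous y).tendsto t).comp hτ)

theorem continuous_apply {X : Type*} [TopologicalSpace X] (hU : IsUnitaryGroup A U) {τ : X → ℝ}
    {x : X → E} (hτ : Continuous τ) (hx : Continuous x) : Continuous fun p => U (τ p) (x p) :=
  continuous_iff_continuousAt.mpr fun p => hU.tendsto_apply (hτ.tendsto p) (hx.tendsto p)

theorem hasDerivAt_apply_zero (hU : IsUnitaryGroup A U) {k : ℝ → E} {k' : E}
    (hk : HasDerivAt k k' 0) (h0 : k 0 = 0) : HasDerivAt (fun τ => U τ (k τ)) k' 0 := by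
  rw [hasDerivAt_iff_tendsto_slope_zero] at hk ⊢
  have h := hU.tendsto_apply (tendsto_id.mono_left nhdsWithin_le_nhds) hk
  simpa only [hU.zero_apply, zero_add, h0, sub_zero, id_eq, map_zero,
    ContinuousLinearMap.map_smul_of_tower] using h

theorem mild_eq (hU : IsUnitaryGroup A U) (hf : Continuous f) (x₀ : E) (t : ℝ) :
    mild U x₀ f t = U t (interaction U x₀ f t) := by
  rw [mild, interaction, map_add, ← ContinuousLinearMap.intervalIntegral_comp_comm (U t)
    ((hU.continuous_apply continuous_neg hf).intervalIntegrable _ _)]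
  simp only [sub_eq_add_neg, hU.add_apply]

theorem hasDerivAt_interaction (hU : IsUnitaryGroup A U) (hf : Continuous f) (x₀ : E) (t : ℝ) :
    HasDerivAt (interaction U x₀ f) (U (-t) (f t)) t :=
  ((hU.continuous_apply continuous_neg hf).integral_hasStrictDerivAt 0 t).hasDerivAt.const_add x₀

theorem continuous_interaction (hU : IsUnitaryGroup A U) (hf : Continuous f) (x₀ : E) :
    Continuous (interaction U x₀ f) :=
  continuous_iff_continuousAt.mpr fun t => (hU.hasDerivAt_interaction hf x₀ t).continuousAt

theorem continuous_mild (hU : IsUnitaryGroup A U) (hf : Continuous f) (x₀ : E) :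
    Continuous (mild U x₀ f) := by
  rw [funext (hU.mild_eq hf x₀)]
  exact hU.continuous_apply continuous_id (hU.continuous_interaction hf x₀)

theorem hasDerivAt_integral_apply_interaction (hU : IsUnitaryGroup A U) (hf : Continuous f)
    (x₀ : E) (a b : ℝ) :
    HasDerivAt (fun τ => ∫ s in a..b, U s (interaction U x₀ f (s + τ))) (∫ s in a..b, f s) 0 := by
  have hφ := hU.continuous_interaction hf x₀
  obtain ⟨C, hC⟩ := ((isCompact_uIcc (a := a) (b := b)).prod
    (isCompact_closedBall (0 : ℝ) 1)).exists_bound_of_continuousOn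
    (f := fun p : ℝ × ℝ => f (p.1 + p.2)) (hf.comp (continuous_fst.add continuous_snd)).continuousOn
  have hcont (τ : ℝ) : Continuous fun s => U s (interaction U x₀ f (s + τ)) :=
    hU.continuous_apply continuous_id (hφ.comp (continuous_add_const τ))
  have h := (intervalIntegral.hasDerivAt_integral_of_dominated_loc_of_deriv_le (a := a) (b := b)
    (F := fun τ s => U s (interaction U x₀ f (s + τ)))
    (F' := fun τ s => U s (U (-(s + τ)) (f (s + τ)))) (bound := fun _ => C) (x₀ := (0 : ℝ))
    (Metric.closedBall_mem_nhds 0 one_pos)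
    (Eventually.of_forall fun τ => (hcont τ).aestronglyMeasurable)
    ((hcont 0).intervalIntegrable a b)
    (hU.continuous_apply continuous_id (hU.continuous_apply (continuous_add_const 0).neg
      (hf.comp (continuous_add_const 0)))).aestronglyMeasurable
    (ae_of_all _ fun s hs τ hτ => by
      rw [hU.norm_apply, hU.norm_apply]
      exact hC (s, τ) ⟨uIoc_subset_uIcc hs, hτ⟩)
    (intervalIntegrable_const (μ := volume))
    (ae_of_all _ fun s _ τ _ => ((U s).restrictScalars ℝ).hasFDerivAt.comp_hasDerivAt τ
      ((hU.hasDerivAt_interaction hf x₀ (s + τ)).comp_const_add s τ))).2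
  simpa only [add_zero, hU.apply_neg_apply] using h

theorem integral_mild_mem_graph (hU : IsUnitaryGroup A U) (hf : Continuous f) (x₀ : E) (a b : ℝ) :
    (∫ s in a..b, mild U x₀ f s,
      Complex.I • (mild U x₀ f b - mild U x₀ f a - ∫ s in a..b, f s)) ∈ A.graph := by
  set w := mild U x₀ f with hw
  have hwc : Continuous w := hU.continuous_mild hf x₀
  set k : ℝ → E := fun τ => ∫ s in a..b, U s (interaction U x₀ f (s + τ)) with hk
  have hk0 : k 0 = ∫ s in a..b, w s := by simp only [hk, hw, add_zero, hU.mild_eq hf]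
  have hcont (τ : ℝ) : Continuous fun s => U s (interaction U x₀ f (s + τ)) :=
    hU.continuous_apply continuous_id
      ((hU.continuous_interaction hf x₀).comp (continuous_add_const τ))
  have htranslate (τ : ℝ) : U τ (k τ) = ∫ s in (a + τ)..(b + τ), w s := by
    rw [← intervalIntegral.integral_comp_add_right, ← ContinuousLinearMap.intervalIntegral_comp_comm
      (U τ) ((hcont τ).intervalIntegrable a b)]
    simp only [hw, hU.mild_eq hf, add_comm _ τ, hU.add_apply]
  have hshift (c : ℝ) : HasDerivAt (fun τ => ∫ s in (0 : ℝ)..(c + τ), w s) (w c) 0 := by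
    have h := (hwc.integral_hasStrictDerivAt 0 (c + 0)).hasDerivAt.comp_const_add c 0
    rwa [add_zero] at h
  have hderiv := ((hshift b).sub (hshift a)).sub (hU.hasDerivAt_apply_zero
    ((hU.hasDerivAt_integral_apply_interaction hf x₀ a b).sub_const (k 0)) (sub_self _))
  rw [hU.generator, smul_smul, Complex.I_mul_I, neg_one_smul, neg_neg]
  refine hderiv.congr_of_eventuallyEq (Eventually.of_forall fun τ => ?_)
  change U τ (∫ s in a..b, w s) = (∫ s in (0 : ℝ)..(b + τ), w s) - (∫ s in (0 : ℝ)..(a + τ), w s) -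
    U τ (k τ - k 0)
  rw [intervalIntegral.integral_interval_sub_left (hwc.intervalIntegrable _ _)
    (hwc.intervalIntegrable _ _), ← htranslate, map_sub, sub_sub_cancel, hk0]

theorem norm_mild (hU : IsUnitaryGroup A U) (hf : Continuous f) (x₀ : E) {b : ℝ} (hb : 0 ≤ b)
    (h : ∀ t ∈ Icc 0 b, (inner ℂ (mild U x₀ f t) (f t)).re = 0) : ‖mild U x₀ f b‖ = ‖x₀‖ := by
  set φ := interaction U x₀ f with hφ
  have hd : ∀ t ∈ Icc 0 b, HasDerivAt (fun t => (inner ℂ (φ t) (φ t)).re) 0 t := by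
    intro t ht
    have hφ' := hU.hasDerivAt_interaction hf x₀ t
    have horth : (inner ℂ (φ t) (U (-t) (f t))).re = 0 := by
      rw [← hU.inner_apply_apply t, hU.apply_neg_apply, ← hU.mild_eq hf]
      exact h t ht
    refine (Complex.reCLM.hasFDerivAt.comp_hasDerivAt t (hφ'.inner ℂ hφ')).congr_deriv ?_
    rw [Complex.reCLM_apply, Complex.add_re, ← hφ, horth, ← inner_conj_symm (U (-t) (f t)),
      Complex.conj_re, horth, add_zero]
  have hconst := constant_of_has_deriv_right_zero
    (fun t ht => (hd t ht).continuousAt.continuousWithinAt)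
    (fun t ht => (hd t ⟨ht.1, ht.2.le⟩).hasDerivWithinAt) b ⟨hb, le_rfl⟩
  have h0 : φ 0 = x₀ := by
    rw [hφ, interaction, intervalIntegral.integral_same, add_zero]
  rw [h0] at hconst
  rw [hU.mild_eq hf, hU.norm_apply, @norm_eq_sqrt_re_inner ℂ, @norm_eq_sqrt_re_inner ℂ E _ _ _ x₀]
  exact congrArg Real.sqrt hconst

end IsUnitaryGroup

end Mild

/-! ### Conservation laws for mild solutions -/

section Steklov

variable {E : Type*} [NormedAddCommGroup E] [NormedSpace ℝ E] {g : ℝ → E}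

/-- The Steklov average `h⁻¹ ∫ₜᵗ⁺ʰ g`, which regularizes a continuous curve in time. -/
def steklovAverage (h : ℝ) (g : ℝ → E) (t : ℝ) : E := h⁻¹ • ∫ r in t..(t + h), g r

variable [CompleteSpace E]

theorem hasDerivAt_steklovAverage (hg : Continuous g) (h t : ℝ) :
    HasDerivAt (steklovAverage h g) (h⁻¹ • (g (t + h) - g t)) t := by
  have hright := (hg.integral_hasStrictDerivAt 0 (t + h)).hasDerivAt.comp_add_const t h
  have hleft := (hg.integral_hasStrictDerivAt 0 t).hasDerivAt
  refine ((hright.sub hleft).const_smul h⁻¹).congr_of_eventuallyEq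
    (Eventually.of_forall fun s => ?_)
  exact congrArg (h⁻¹ • ·) (intervalIntegral.integral_interval_sub_left (hg.intervalIntegrable _ _)
    (hg.intervalIntegrable _ _)).symm

theorem tendsto_steklovAverage (hg : Continuous g) (t : ℝ) :
    Tendsto (fun h => steklovAverage h g t) (𝓝[>] 0) (𝓝 (g t)) := by
  have h := (hasDerivAt_iff_tendsto_slope_zero.mp
    (hg.integral_hasStrictDerivAt t t).hasDerivAt).mono_left (nhdsGT_le_nhdsNE 0)
  simpa only [steklovAverage, intervalIntegral.integral_same, sub_zero] using h

end Steklov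

section Conservation

variable {X E : Type*} [NormedAddCommGroup X] [NormedSpace ℂ X] [NormedAddCommGroup E]
  [InnerProductSpace ℂ E]

/-- `B` is a symmetric form representing the operator `A` on a form domain `X`, which is mapped
into the ambient Hilbert space by `ι`. -/
structure IsFormOf (A : E →ₗ.[ℂ] E) (ι : X →L[ℂ] E) (B : X →L⋆[ℂ] X →L[ℂ] ℂ) : Prop where
  conj_apply : ∀ u v, conj (B u v) = B v u
  inner_eq : ∀ u v y, (ι u, y) ∈ A.graph → inner ℂ (ι v) y = B v u

/-- `N` is the gradient of `V` for the inner product of `E`, locally Lipschitz on `X` even for the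
weaker norm of `E`, and the first order Taylor remainder of `V` is quadratic in that norm. -/
def HasLipschitzGradient (ι : X →L[ℂ] E) (V : X → ℝ) (N : X → E) : Prop :=
  ∀ M, ∃ L, 0 ≤ L ∧ ∀ u v, ‖u‖ ≤ M → ‖v‖ ≤ M → ‖N u - N v‖ ≤ L * ‖ι (u - v)‖ ∧
    |V u - V v - (inner ℂ (N v) (ι (u - v))).re| ≤ L * ‖ι (u - v)‖ ^ 2

/-- `Ψ` is an `X`-continuous curve solving `i Ψ' = A Ψ - N(Ψ)` on `[0, b]` in the mild sense, where
`U(t) = e^{-itA}`. -/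
structure IsMildSolution [CompleteSpace E] (U : ℝ → E →L[ℂ] E) (ι : X →L[ℂ] E) (N : X → E)
    (b : ℝ) (Ψ : ℝ → X) : Prop where
  continuous : Continuous Ψ
  eq_mild : ∀ t ∈ Icc 0 b, ι (Ψ t) = mild U (ι (Ψ 0)) (fun s => Complex.I • N (Ψ s)) t

/-- The energy `½ B(u, u) - V(u)`. -/
def formEnergy (B : X →L⋆[ℂ] X →L[ℂ] ℂ) (V : X → ℝ) (u : X) : ℝ := 1 / 2 * (B u u).re - V u

/-- A regularization of the energy along a curve: the quadratic part is evaluated at the Steklov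
average of the curve, whereas it is the value of the potential which is averaged. -/
def steklovEnergy (B : X →L⋆[ℂ] X →L[ℂ] ℂ) (V : X → ℝ) (Ψ : ℝ → X) (h t : ℝ) : ℝ :=
  1 / 2 * (B (steklovAverage h Ψ t) (steklovAverage h Ψ t)).re
    - steklovAverage h (fun s => V (Ψ s)) t

variable {A : E →ₗ.[ℂ] E} {U : ℝ → E →L[ℂ] E} {ι : X →L[ℂ] E} {B : X →L⋆[ℂ] X →L[ℂ] ℂ}
  {N : X → E} {V : X → ℝ} {Ψ : ℝ → X} {b : ℝ}

theorem isBoundedBilinearMap_of_sesquilinear (B : X →L⋆[ℂ] X →L[ℂ] ℂ) :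
    IsBoundedBilinearMap ℝ fun p : X × X => B p.1 p.2 where
  add_left u u' v := by rw [map_add, add_apply]
  smul_left r u v := by
    rw [← Complex.coe_smul, map_smulₛₗ, Complex.conj_ofReal, smul_apply,
      Complex.coe_smul]
  add_right u v v' := map_add _ _ _
  smul_right r u v := ContinuousLinearMap.map_smul_of_tower _ _ _
  bound := ⟨‖B‖ + 1, by positivity, fun u v => (B.le_opNorm₂ u v).trans (by gcongr; linarith)⟩

namespace HasLipschitzGradient

theorem continuous_gradient (hV : HasLipschitzGradient ι V N) : Continuous N := by
  refine continuous_iff_continuousAt.mpr fun v => tendsto_iff_norm_sub_tendsto_zero.mpr ?_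
  obtain ⟨L, -, hL⟩ := hV (‖v‖ + 1)
  have hlim : Tendsto (fun u => L * ‖ι (u - v)‖) (𝓝 v) (𝓝 (L * ‖ι (v - v)‖)) :=
    Continuous.tendsto (by fun_prop) v
  rw [sub_self, map_zero, norm_zero, mul_zero] at hlim
  refine squeeze_zero' (Eventually.of_forall fun _ => norm_nonneg _) ?_ hlim
  filter_upwards [continuous_norm.continuousAt.eventually_le_const (lt_add_one ‖v‖)] with u hu
  exact (hL u v hu (by linarith)).1

theorem continuous (hV : HasLipschitzGradient ι V N) : Continuous V := by
  refine continuous_iff_continuousAt.mpr fun v => tendsto_iff_norm_sub_tendsto_zero.mpr ?_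
  obtain ⟨L, -, hL⟩ := hV (‖v‖ + 1)
  have hlim : Tendsto (fun u => L * ‖ι (u - v)‖ ^ 2 + |(inner ℂ (N v) (ι (u - v))).re|) (𝓝 v)
      (𝓝 (L * ‖ι (v - v)‖ ^ 2 + |(inner ℂ (N v) (ι (v - v))).re|)) :=
    Continuous.tendsto (by fun_prop) v
  simp only [sub_self, map_zero, norm_zero, inner_zero_right, Complex.zero_re, abs_zero, add_zero,
    mul_zero, ne_eq, OfNat.ofNat_ne_zero, not_false_eq_true, zero_pow] at hlim
  refine squeeze_zero' (Eventually.of_forall fun _ => norm_nonneg _) ?_ hlim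
  filter_upwards [continuous_norm.continuousAt.eventually_le_const (lt_add_one ‖v‖)] with u hu
  exact (sub_le_iff_le_add.mp (abs_sub_abs_le_abs_sub _ _)).trans
    (add_le_add_left (hL u v hu (by linarith)).2 _)

end HasLipschitzGradient

section Steklov

variable [CompleteSpace X]

theorem tendsto_steklovEnergy (hV : Continuous V) (hΨ : Continuous Ψ) (t : ℝ) :
    Tendsto (fun h => steklovEnergy B V Ψ h t) (𝓝[>] 0) (𝓝 (formEnergy B V (Ψ t))) := by
  have hB := (isBoundedBilinearMap_of_sesquilinear B).continuous
  have hquad : Continuous fun u => 1 / 2 * (B u u).re :=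
    continuous_const.mul (Complex.continuous_re.comp (hB.comp (continuous_id.prodMk continuous_id)))
  exact ((hquad.tendsto (Ψ t)).comp (tendsto_steklovAverage hΨ t)).sub
    (tendsto_steklovAverage (hV.comp hΨ) t)

theorem hasDerivAt_steklovEnergy (hB : ∀ u v, conj (B u v) = B v u) (hV : Continuous V)
    (hΨ : Continuous Ψ) (h t : ℝ) :
    HasDerivAt (steklovEnergy B V Ψ h)
      (h⁻¹ * (h⁻¹ * (B (Ψ (t + h) - Ψ t) (∫ s in t..(t + h), Ψ s)).re
        - (V (Ψ (t + h)) - V (Ψ t)))) t := by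
  have hS := hasDerivAt_steklovAverage hΨ h t
  have hquad := (((isBoundedBilinearMap_of_sesquilinear B).hasFDerivAt _).comp_hasDerivAt t
    (hS.prodMk hS))
  have hpot := hasDerivAt_steklovAverage (hV.comp hΨ) h t
  refine (((Complex.reCLM.hasFDerivAt.comp_hasDerivAt t hquad).const_mul (1 / 2)).sub
    hpot).congr_deriv ?_
  have hsymm (u v : X) : (B u v).re = (B v u).re := by rw [← hB, Complex.conj_re]
  rw [IsBoundedBilinearMap.deriv_apply, map_add, Complex.reCLM_apply, Complex.reCLM_apply,
    hsymm (steklovAverage h Ψ t), steklovAverage,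
    (isBoundedBilinearMap_of_sesquilinear B).smul_left,
    (isBoundedBilinearMap_of_sesquilinear B).smul_right, Complex.smul_re, Complex.smul_re]
  simp only [smul_eq_mul, Function.comp_apply]
  ring

end Steklov

namespace IsMildSolution

variable [CompleteSpace E]

theorem norm_eq (hΨ : IsMildSolution U ι N b Ψ) (hU : IsUnitaryGroup A U) (hN : Continuous N)
    (hgauge : ∀ u, (inner ℂ (ι u) (N u)).im = 0) {t : ℝ} (ht : t ∈ Icc 0 b) :
    ‖ι (Ψ t)‖ = ‖ι (Ψ 0)‖ := by
  rw [hΨ.eq_mild t ht]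
  refine hU.norm_mild (f := fun s => Complex.I • N (Ψ s))
    ((hN.comp hΨ.continuous).const_smul Complex.I) _ ht.1 fun s hs => ?_
  rw [← hΨ.eq_mild s ⟨hs.1, hs.2.trans ht.2⟩, inner_smul_right, Complex.I_mul_re, hgauge, neg_zero]

variable [CompleteSpace X]

theorem form_integral_eq (hΨ : IsMildSolution U ι N b Ψ) (hU : IsUnitaryGroup A U)
    (hB : IsFormOf A ι B) (hN : Continuous N) {a c : ℝ} (ha : a ∈ Icc 0 b) (hc : c ∈ Icc 0 b)
    (v : X) :
    B v (∫ s in a..c, Ψ s) = Complex.I * inner ℂ (ι v) (ι (Ψ c - Ψ a))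
      + inner ℂ (ι v) (∫ s in a..c, N (Ψ s)) := by
  have hmem := hU.integral_mild_mem_graph (f := fun s => Complex.I • N (Ψ s))
    ((hN.comp hΨ.continuous).const_smul Complex.I) (ι (Ψ 0)) a c
  have hint : ∫ s in a..c, mild U (ι (Ψ 0)) (fun s => Complex.I • N (Ψ s)) s =
      ι (∫ s in a..c, Ψ s) := by
    rw [← ContinuousLinearMap.intervalIntegral_comp_comm ι (hΨ.continuous.intervalIntegrable _ _)]
    exact intervalIntegral.integral_congr fun s hs =>
      (hΨ.eq_mild s (uIcc_subset_Icc ha hc hs)).symm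
  rw [hint, ← hΨ.eq_mild a ha, ← hΨ.eq_mild c hc, ← map_sub, intervalIntegral.integral_smul,
    smul_sub, smul_smul, Complex.I_mul_I, neg_one_smul, sub_neg_eq_add] at hmem
  rw [← hB.inner_eq _ v _ hmem, inner_add_right, inner_smul_right]

theorem exists_norm_sub_sq_le (hΨ : IsMildSolution U ι N b Ψ) (hU : IsUnitaryGroup A U)
    (hB : IsFormOf A ι B) (hN : Continuous N) :
    ∃ K, 0 ≤ K ∧ ∀ a c, 0 ≤ a → a ≤ c → c ≤ b →
      ‖ι (Ψ c - Ψ a)‖ ^ 2 ≤ K * (c - a) * ‖Ψ c - Ψ a‖ := by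
  obtain ⟨M, hM⟩ := isCompact_Icc.exists_bound_of_continuousOn
    (hΨ.continuous.continuousOn (s := Icc 0 b))
  obtain ⟨M', hM'⟩ := isCompact_Icc.exists_bound_of_continuousOn
    ((hN.comp hΨ.continuous).continuousOn (s := Icc 0 b))
  refine ⟨‖B‖ * |M| + ‖ι‖ * |M'|, by positivity, fun a c ha hac hc => ?_⟩
  have hsub : uIoc a c ⊆ Icc 0 b := by
    rw [uIoc_of_le hac]
    exact fun s hs => ⟨ha.trans hs.1.le, hs.2.trans hc⟩
  have hca : |c - a| = c - a := abs_of_nonneg (sub_nonneg.mpr hac)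
  have hI : ‖∫ s in a..c, Ψ s‖ ≤ |M| * (c - a) := hca ▸
    intervalIntegral.norm_integral_le_of_norm_le_const fun s hs =>
      (hM s (hsub hs)).trans (le_abs_self M)
  have hI' : ‖∫ s in a..c, N (Ψ s)‖ ≤ |M'| * (c - a) := hca ▸
    intervalIntegral.norm_integral_le_of_norm_le_const fun s hs =>
      (hM' s (hsub hs)).trans (le_abs_self M')
  set v := Ψ c - Ψ a
  have htest := hΨ.form_integral_eq hU hB hN ⟨ha, hac.trans hc⟩ ⟨ha.trans hac, hc⟩ v
  calc ‖ι v‖ ^ 2 = ‖Complex.I * inner ℂ (ι v) (ι v)‖ := by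
        rw [norm_mul, Complex.norm_I, one_mul, inner_self_eq_norm_sq_to_K, norm_pow,
          RCLike.norm_ofReal, abs_norm]
    _ = ‖B v (∫ s in a..c, Ψ s) - inner ℂ (ι v) (∫ s in a..c, N (Ψ s))‖ := by
        rw [htest, add_sub_cancel_right]
    _ ≤ ‖B‖ * ‖v‖ * (|M| * (c - a)) + ‖ι‖ * ‖v‖ * (|M'| * (c - a)) := by
        refine norm_sub_le_of_le ((B.le_opNorm₂ _ _).trans (by gcongr))
          ((norm_inner_le_norm _ _).trans ?_)
        gcongr
        exact ι.le_opNorm v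
    _ = (‖B‖ * |M| + ‖ι‖ * |M'|) * (c - a) * ‖v‖ := by ring

/-- Evaluating the quadratic part at an average of the curve produces terms of first order, which
cancel against those of the potential: only remainders quadratic in `ι (Ψ s - Ψ t)` are left. -/
theorem hasDerivAt_steklovEnergy (hΨ : IsMildSolution U ι N b Ψ) (hU : IsUnitaryGroup A U)
    (hB : IsFormOf A ι B) (hN : Continuous N) (hV : Continuous V) {h t : ℝ} (hh : h ≠ 0)
    (ht : t ∈ Icc 0 b) (hth : t + h ∈ Icc 0 b) :
    HasDerivAt (steklovEnergy B V Ψ h)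
      (h⁻¹ * (h⁻¹ * (inner ℂ (ι (Ψ (t + h) - Ψ t)) (∫ s in t..(t + h), (N (Ψ s) - N (Ψ t)))).re
        - (V (Ψ (t + h)) - V (Ψ t) - (inner ℂ (N (Ψ t)) (ι (Ψ (t + h) - Ψ t))).re))) t := by
  refine (DeltaPrime.hasDerivAt_steklovEnergy hB.conj_apply hV hΨ.continuous h t).congr_deriv ?_
  set v := Ψ (t + h) - Ψ t
  have hsplit : ∫ s in t..(t + h), N (Ψ s) =
      (∫ s in t..(t + h), (N (Ψ s) - N (Ψ t))) + (h : ℂ) • N (Ψ t) := by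
    have hint : IntervalIntegrable (fun s => N (Ψ s)) volume t (t + h) :=
      (hN.comp hΨ.continuous).intervalIntegrable _ _
    rw [intervalIntegral.integral_sub hint intervalIntegrable_const,
      intervalIntegral.integral_const, add_sub_cancel_left, Complex.coe_smul, sub_add_cancel]
  have hself : (Complex.I * inner ℂ (ι v) (ι v)).re = 0 := by
    rw [Complex.I_mul_re, neg_eq_zero]
    exact inner_self_im (𝕜 := ℂ) (ι v)
  have hsymm : (inner ℂ (N (Ψ t)) (ι v)).re = (inner ℂ (ι v) (N (Ψ t))).re := by
    rw [← inner_conj_symm, Complex.conj_re]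
  rw [hΨ.form_integral_eq hU hB hN ht hth, Complex.add_re, hself, zero_add, hsplit, inner_add_right,
    inner_smul_right, Complex.add_re, Complex.re_ofReal_mul, hsymm]
  field_simp
  ring

theorem abs_deriv_steklovEnergy_le (hΨ : IsMildSolution U ι N b Ψ) (hU : IsUnitaryGroup A U)
    (hB : IsFormOf A ι B) (hN : Continuous N) (hV : Continuous V) {h t L σ : ℝ} (hh : 0 < h)
    (ht : t ∈ Icc 0 b) (hth : t + h ∈ Icc 0 b) (hL : 0 ≤ L)
    (hσ : ∀ s ∈ Icc t (t + h), ‖ι (Ψ s - Ψ t)‖ ≤ σ)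
    (hgrad : ∀ s ∈ Icc t (t + h), ‖N (Ψ s) - N (Ψ t)‖ ≤ L * ‖ι (Ψ s - Ψ t)‖)
    (hrem : |V (Ψ (t + h)) - V (Ψ t) - (inner ℂ (N (Ψ t)) (ι (Ψ (t + h) - Ψ t))).re|
      ≤ L * ‖ι (Ψ (t + h) - Ψ t)‖ ^ 2) :
    |deriv (steklovEnergy B V Ψ h) t| ≤ 2 * L * h⁻¹ * σ ^ 2 := by
  have hend : ‖ι (Ψ (t + h) - Ψ t)‖ ≤ σ := hσ _ (right_mem_Icc.mpr (by linarith))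
  have hσ0 : 0 ≤ σ := (norm_nonneg _).trans hend
  have hint : ‖∫ s in t..(t + h), (N (Ψ s) - N (Ψ t))‖ ≤ L * σ * h := by
    have hbound := intervalIntegral.norm_integral_le_of_norm_le_const (a := t) (b := t + h)
      (f := fun s => N (Ψ s) - N (Ψ t)) (C := L * σ) fun s hs => by
        rw [uIoc_of_le (by linarith)] at hs
        have hs' := Ioc_subset_Icc_self hs
        exact (hgrad s hs').trans (by gcongr; exact hσ s hs')
    rwa [add_sub_cancel_left, abs_of_pos hh] at hbound
  rw [(hΨ.hasDerivAt_steklovEnergy hU hB hN hV hh.ne' ht hth).deriv, abs_mul,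
    abs_of_pos (inv_pos.mpr hh)]
  calc _ ≤ h⁻¹ * (h⁻¹ * (σ * (L * σ * h)) + L * σ ^ 2) := by
        refine mul_le_mul_of_nonneg_left ((abs_sub _ _).trans (add_le_add ?_ ?_)) (by positivity)
        · rw [abs_mul, abs_of_pos (inv_pos.mpr hh)]
          refine mul_le_mul_of_nonneg_left ((Complex.abs_re_le_norm _).trans
            ((norm_inner_le_norm _ _).trans ?_)) (by positivity)
          gcongr
        · exact hrem.trans (by gcongr)
    _ = 2 * L * h⁻¹ * σ ^ 2 := by field_simp; ring

theorem exists_abs_deriv_steklovEnergy_le (hΨ : IsMildSolution U ι N b Ψ)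
    (hU : IsUnitaryGroup A U) (hB : IsFormOf A ι B) (hV : HasLipschitzGradient ι V N) :
    ∃ C, 0 ≤ C ∧ ∀ h t ε, 0 < h → 0 ≤ t → t + h ≤ b → (∀ s ∈ Icc t (t + h), ‖Ψ s - Ψ t‖ ≤ ε) →
      |deriv (steklovEnergy B V Ψ h) t| ≤ C * ε := by
  obtain ⟨M, hM⟩ := isCompact_Icc.exists_bound_of_continuousOn
    (hΨ.continuous.continuousOn (s := Icc 0 b))
  obtain ⟨L, hL0, hL⟩ := hV M
  obtain ⟨K, hK0, hK⟩ := hΨ.exists_norm_sub_sq_le hU hB hV.continuous_gradient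
  refine ⟨2 * L * K, by positivity, fun h t ε hh ht hth hε => ?_⟩
  have htb : t ∈ Icc 0 b := ⟨ht, by linarith⟩
  have hsub : ∀ s ∈ Icc t (t + h), s ∈ Icc 0 b := fun s hs => ⟨ht.trans hs.1, hs.2.trans hth⟩
  have hend : t + h ∈ Icc t (t + h) := right_mem_Icc.mpr (by linarith)
  have hε0 : 0 ≤ ε := (norm_nonneg _).trans (hε _ hend)
  have hσ : ∀ s ∈ Icc t (t + h), ‖ι (Ψ s - Ψ t)‖ ≤ √(K * h * ε) := fun s hs => by
    refine Real.le_sqrt_of_sq_le ((hK t s ht hs.1 (hs.2.trans hth)).trans ?_)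
    have hst : s - t ≤ h := by linarith [hs.2]
    gcongr
    exact hε s hs
  calc |deriv (steklovEnergy B V Ψ h) t| ≤ 2 * L * h⁻¹ * √(K * h * ε) ^ 2 :=
        hΨ.abs_deriv_steklovEnergy_le hU hB hV.continuous_gradient hV.continuous hh htb
          (hsub _ hend) hL0 hσ (fun s hs => (hL _ _ (hM s (hsub s hs)) (hM t htb)).1)
          (hL _ _ (hM _ (hsub _ hend)) (hM t htb)).2
    _ = 2 * L * K * ε := by rw [Real.sq_sqrt (by positivity)]; field_simp

theorem formEnergy_eq (hΨ : IsMildSolution U ι N b Ψ) (hU : IsUnitaryGroup A U)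
    (hB : IsFormOf A ι B) (hV : HasLipschitzGradient ι V N) {t : ℝ} (ht : t ∈ Ico 0 b) :
    formEnergy B V (Ψ t) = formEnergy B V (Ψ 0) := by
  obtain ⟨C, hC0, hC⟩ := hΨ.exists_abs_deriv_steklovEnergy_le hU hB hV
  have hlim (s : ℝ) : Tendsto (fun h => steklovEnergy B V Ψ h s) (𝓝[>] 0)
      (𝓝 (formEnergy B V (Ψ s))) := tendsto_steklovEnergy hV.continuous hΨ.continuous s
  suffices hzero : Tendsto (fun h => steklovEnergy B V Ψ h t - steklovEnergy B V Ψ h 0)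
      (𝓝[>] 0) (𝓝 0) from
    sub_eq_zero.mp (tendsto_nhds_unique ((hlim t).sub (hlim 0)) hzero)
  rw [Metric.tendsto_nhds]
  intro η hη
  have hpos : 0 < C * t + 1 := by nlinarith [ht.1]
  set ε := η / (C * t + 1) with hεdef
  obtain ⟨δ, hδ, hδε⟩ := Metric.uniformContinuousOn_iff.mp
    (isCompact_Icc.uniformContinuousOn_of_continuous
      (hΨ.continuous.continuousOn (s := Icc 0 b))) ε (by positivity)
  filter_upwards [Ioo_mem_nhdsGT (lt_min hδ (sub_pos.mpr ht.2))] with h ⟨hh, hhmin⟩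
  obtain ⟨hhδ, hhb⟩ := lt_min_iff.mp hhmin
  have hosc (s : ℝ) (hs : s ∈ Ico 0 t) : ∀ r ∈ Icc s (s + h), ‖Ψ r - Ψ s‖ ≤ ε := fun r hr => by
    rw [← dist_eq_norm]
    refine (hδε r ⟨hs.1.trans hr.1, by linarith [hr.2, hs.2]⟩ s ⟨hs.1, by linarith [hs.2]⟩ ?_).le
    rw [Real.dist_eq, abs_of_nonneg (sub_nonneg.mpr hr.1)]
    linarith [hr.2]
  have hdrift := norm_image_sub_le_of_norm_deriv_le_segment'
    (fun s _ => (DeltaPrime.hasDerivAt_steklovEnergy hB.conj_apply hV.continuous hΨ.continuous h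
      s).differentiableAt.hasDerivAt.hasDerivWithinAt)
    (fun s hs => hC h s ε hh hs.1 (by linarith [hs.2]) (hosc s hs)) t ⟨ht.1, le_rfl⟩
  rw [dist_zero_right]
  refine hdrift.trans_lt ?_
  rw [sub_zero, hεdef, mul_right_comm, mul_div_assoc', div_lt_iff₀ hpos]
  nlinarith

end IsMildSolution

end Conservation

/-! ### The nonlinear Schrödinger equation with a `δ'` interaction -/

section Application

variable {γ l μ : ℝ}

/-- The potential part `(l / (2μ+2)) ‖u‖_{2μ+2}^{2μ+2}` of the energy. -/
def potential (l μ : ℝ) (u : Q) : ℝ := l / (2 * μ + 2) * ∫ x, ‖u.fn x‖ ^ (2 * μ + 2)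

/-- The nonlinear term `l |u|^{2μ} u` of the equation, on the energy space. -/
def force (l μ : ℝ) (u : Q) : L2 := (l : ℂ) • nonlinearity μ u.fn

theorem isFormOf_form (hγ : γ ≠ 0) : IsFormOf (hamiltonian γ) Q.fnL (form γ) where
  conj_apply := conj_form γ
  inner_eq _ v _ h := inner_eq_form hγ (hamiltonian_graph γ ▸ h) v

theorem energy_eq_formEnergy (γ l μ : ℝ) (u : Q) :
    energy γ l μ u = formEnergy (form γ) (potential l μ) u := by
  rw [energy, formEnergy, potential, re_form_self, ← one_div_mul_one_div]
  ring

theorem hasLipschitzGradient_potential (l : ℝ) (hμ : 0 ≤ μ) :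
    HasLipschitzGradient Q.fnL (potential l μ) (force l μ) := by
  intro M
  refine ⟨|l| * (2 * μ + 2) * |M| ^ (2 * μ), by positivity, fun u v hu hv => ?_⟩
  have hu' : ∀ᵐ x, ‖u.fn x‖ ≤ |M| :=
    u.ae_norm_le.mono fun _ h => h.trans (hu.trans (le_abs_self M))
  have hv' : ∀ᵐ x, ‖v.fn x‖ ≤ |M| :=
    v.ae_norm_le.mono fun _ h => h.trans (hv.trans (le_abs_self M))
  rw [map_sub, Q.fnL_apply, Q.fnL_apply]
  have hp : 0 < 2 * μ + 2 := by positivity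
  constructor
  · rw [force, force, ← smul_sub, norm_smul, Complex.norm_real, Real.norm_eq_abs, mul_assoc |l|,
      mul_assoc |l|]
    gcongr
    exact norm_nonlinearity_sub_le hμ hu' hv'
  · have hsplit : potential l μ u - potential l μ v - (inner ℂ (force l μ v) (u.fn - v.fn)).re =
        l / (2 * μ + 2) * ((∫ x, ‖u.fn x‖ ^ (2 * μ + 2)) - (∫ x, ‖v.fn x‖ ^ (2 * μ + 2))
          - (2 * μ + 2) * (inner ℂ (nonlinearity μ v.fn) (u.fn - v.fn)).re) := by
      rw [potential, potential, force, inner_smul_left, Complex.conj_ofReal, Complex.re_ofReal_mul]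
      field_simp
    rw [hsplit, abs_mul, abs_div, abs_of_pos hp]
    refine (mul_le_mul_of_nonneg_left (abs_integral_norm_rpow_sub_sub_inner_le hμ hu' hv')
      (by positivity)).trans_eq ?_
    field_simp

theorem im_inner_force (l : ℝ) (hμ : 0 ≤ μ) (u : Q) :
    (inner ℂ (Q.fnL u) (force l μ u)).im = 0 := by
  rw [force, inner_smul_right, Complex.im_ofReal_mul, Q.fnL_apply,
    im_inner_nonlinearity hμ u.ae_norm_le, mul_zero]

theorem exists_Icc_subset_timeInterval {T : EReal} {t : ℝ} (ht : t ∈ timeInterval T) :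
    ∃ b, t < b ∧ Icc 0 b ⊆ timeInterval T := by
  obtain ⟨b, htb, hbT⟩ := EReal.lt_iff_exists_real_btwn.mp ht.2
  exact ⟨b, EReal.coe_lt_coe_iff.mp htb,
    fun s hs => ⟨hs.1, (EReal.coe_le_coe_iff.mpr hs.2).trans_lt hbT⟩⟩

theorem isUnitaryGroup_unitaryGroup {E : Type*} [NormedAddCommGroup E] [InnerProductSpace ℂ E]
    [CompleteSpace E] {A : E →ₗ.[ℂ] E} (h : ∃ U, IsUnitaryGroup A U) :
    IsUnitaryGroup A (unitaryGroup A) := by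
  rw [unitaryGroup, dif_pos h]
  exact h.choose_spec

namespace IsSolution

variable {T : EReal} {ψ₀ : Q} {ψ : ℝ → Q}

theorem isMildSolution (hψ : IsSolution γ l μ T ψ₀ ψ) {b : ℝ} (hb : 0 ≤ b)
    (hbT : Icc 0 b ⊆ timeInterval T) :
    IsMildSolution (unitaryGroup (hamiltonian γ)) Q.fnL (force l μ) b
      fun s => ψ (projIcc 0 b hb s) where
  continuous := (continuousOn_iff_continuous_domRestrict.mp (hψ.continuousOn.mono hbT)).comp
    continuous_projIcc
  eq_mild t ht := by
    rw [projIcc_of_mem hb ht, projIcc_of_mem hb (left_mem_Icc.mpr hb), Q.fnL_apply, Q.fnL_apply,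
      hψ.initial (hbT (left_mem_Icc.mpr hb)), hψ.duhamel t (hbT ht), mild,
      ← intervalIntegral.integral_smul]
    congr 1
    refine intervalIntegral.integral_congr fun s hs => ?_
    rw [uIcc_of_le ht.1] at hs
    rw [projIcc_of_mem hb ⟨hs.1, hs.2.trans ht.2⟩, force, smul_smul, map_smul]

theorem conservation (hψ : IsSolution γ l μ T ψ₀ ψ)
    (hU : IsUnitaryGroup (hamiltonian γ) (unitaryGroup (hamiltonian γ))) (hγ : γ ≠ 0)
    (hμ : 0 ≤ μ) {t : ℝ} (ht : t ∈ timeInterval T) :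
    ‖(ψ t).fn‖ = ‖ψ₀.fn‖ ∧ energy γ l μ (ψ t) = energy γ l μ ψ₀ := by
  obtain ⟨b, htb, hbT⟩ := exists_Icc_subset_timeInterval ht
  have hb : 0 ≤ b := ht.1.trans htb.le
  have hV := hasLipschitzGradient_potential l hμ
  have hΨ := hψ.isMildSolution hb hbT
  have hnorm := hΨ.norm_eq hU hV.continuous_gradient (im_inner_force l hμ) ⟨ht.1, htb.le⟩
  have henergy := hΨ.formEnergy_eq hU (isFormOf_form hγ) hV ⟨ht.1, htb⟩
  rw [projIcc_of_mem hb ⟨ht.1, htb.le⟩, projIcc_of_mem hb (left_mem_Icc.mpr hb),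
    hψ.initial (hbT (left_mem_Icc.mpr hb))] at hnorm henergy
  rw [energy_eq_formEnergy, energy_eq_formEnergy]
  exact ⟨hnorm, henergy⟩

theorem eq_initial_of_not_exists (hψ : IsSolution γ l μ T ψ₀ ψ)
    (h : ¬∃ U, IsUnitaryGroup (hamiltonian γ) U) {t : ℝ} (ht : t ∈ timeInterval T) :
    ψ t = ψ₀ := by
  have hzero : ∀ s ∈ timeInterval T, Q.fnL (ψ s) = 0 := fun s hs => by
    rw [Q.fnL_apply, hψ.duhamel s hs, unitaryGroup, dif_neg h]
    simp only [Pi.zero_apply, zero_apply, intervalIntegral.integral_zero, smul_zero, add_zero]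
  have h0 : (0 : ℝ) ∈ timeInterval T :=
    ⟨le_rfl, (EReal.coe_le_coe_iff.mpr ht.1).trans_lt ht.2⟩
  rw [← hψ.initial h0]
  exact Q.fnL_injective ((hzero t ht).trans (hzero 0 h0).symm)

end IsSolution

end Application
end DeltaPrime

end

theorem proposition3p4_general (γ l μ : ℝ) (hγ : γ ≠ 0) (hμ : 0 ≤ μ)
    (T : EReal) (ψ₀ : DeltaPrime.Q) (ψ : ℝ → DeltaPrime.Q)
    (hψ : DeltaPrime.IsSolution γ l μ T ψ₀ ψ) :
    ∀ t ∈ DeltaPrime.timeInterval T,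
      ‖(ψ t).fn‖ = ‖ψ₀.fn‖ ∧
      DeltaPrime.energy γ l μ (ψ t) = DeltaPrime.energy γ l μ ψ₀ := by
  intro t ht
  by_cases h : ∃ U, DeltaPrime.IsUnitaryGroup (DeltaPrime.hamiltonian γ) U
  · exact hψ.conservation (DeltaPrime.isUnitaryGroup_unitaryGroup h) hγ hμ ht
  · -- The convention `U = 0` of `unitaryGroup` then leaves only the zero solution.
    rw [hψ.eq_initial_of_not_exists h ht]
    exact ⟨rfl, rfl⟩

theorem proposition3p4 (γ l μ : ℝ) (hγ : 0 < γ) (hl : 0 < l) (hμ : 0 < μ)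
    (T : EReal) (ψ₀ : DeltaPrime.Q) (ψ : ℝ → DeltaPrime.Q)
    (hψ : DeltaPrime.IsSolution γ l μ T ψ₀ ψ) :
    ∀ t ∈ DeltaPrime.timeInterval T,
      ‖(ψ t).fn‖ = ‖ψ₀.fn‖ ∧
      DeltaPrime.energy γ l μ (ψ t) = DeltaPrime.energy γ l μ ψ₀ :=
  proposition3p4_general γ l μ hγ.ne' hμ.le T ψ₀ ψ hψ
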